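/- Theorem. Let $\Bbbk$ be a commutative ring, let $\phi: G\to H$ be a morphism of (arbitrary) groups with kernel $L$, and let $d=\operatorname{projdim}_{\Bbbk[L]}\Bbbk$ be the (possibly infinite) projective dimension of the trivial $\Bbbk[L]$-module $\Bbbk$. Let $A=\bigoplus_{g\in G}A_g$ be a $G$-graded associative unital $\Bbbk$-algebra, i.e. each $A_g$ is a $\Bbbk$-submodule and $A_gA_{g'}\subseteq A_{gg'}$ for all $g,g'\in G$. Let $\operatorname{Gr}_G A$ be the abelian category of $G$-graded left $A$-modules $M=\bigoplus_{g\in G}M_g$ (with $A_gM_{g'}\subseteq M_{gg'}$) and degree-preserving $A$-linear maps. Regard $A$ also as an $H$-graded algebra with $A_h=\bigoplus_{\phi(g)=h}A_g$, and let $\phi_!:\operatorname{Gr}_G A\to\operatorname{Gr}_H A$ be the functor sending $M$ to the same $A$-module with the $H$-grading $\phi_!(M)_h=\bigoplus_{\phi(g)=h}M_g$. Write $\operatorname{injdim}^G_A$ and $\operatorname{injdim}^H_A$ for the injective dimensions in $\operatorname{Gr}_G A$ and $\operatorname{Gr}_H A$ (with values in $\{-\infty\}\cup\mathbb N\cup\{\infty\}$;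 projective and injective dimensions of zero objects are $-\infty$, and $-\infty$ plus anything is $-\infty$). Assume that $A$ is left $G$-graded noetherian: every graded $A$-submodule of a finitely generated $G$-graded left $A$-module is finitely generated. Then for every object $M$ of $\operatorname{Gr}_G A$, $$\operatorname{injdim}^G_A M \;\le\; \operatorname{injdim}^H_A \phi_!(M) \;\le\; \operatorname{injdim}^G_A M + d .$$ In particular, if $I$ is an injective object of $\operatorname{Gr}_G A$, then $\operatorname{injdim}^H_A\phi_!(I)\le d$. -/

import Mathlib

open CategoryTheory CategoryTheory.Limits

universe u

namespace GroupGraded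

/-! ### Decompositions indexed by a group -/

section Internal

variable {ι M S : Type*} [AddCommGroup M] [SetLike S M] [AddSubmonoidClass S M]

/-- `M` is the (internal) direct sum of the family `D` of its additive subobjects. -/
def IsGrading (D : ι → S) : Prop :=
  open scoped Classical in DirectSum.IsInternal D

/-- The projection of `M` onto its `i`-th homogeneous component. -/
noncomputable def IsGrading.proj {D : ι → S} (h : IsGrading D) (i : ι) : M →+ M := by
  classical
  letI := DirectSum.IsInternal.chooseDecomposition D h
  exact
    { toFun := fun x => (DirectSum.decompose D x i : M)
      map_zero' := by simp
      map_add' := by intro x y; simp }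

theorem IsGrading.proj_mem {D : ι → S} (h : IsGrading D) (i : ι) (x : M) :
    h.proj i x ∈ D i := by
  classical
  let := DirectSum.IsInternal.chooseDecomposition D h
  exact (DirectSum.decompose D x i).2

theorem IsGrading.proj_of_mem {D : ι → S} (h : IsGrading D) {i : ι} {x : M} (hx : x ∈ D i) :
    h.proj i x = x := by
  classical
  let := DirectSum.IsInternal.chooseDecomposition D h
  exact DirectSum.decompose_of_mem_same D hx

theorem IsGrading.proj_of_mem_ne {D : ι → S} (h : IsGrading D) {i j : ι} {x : M}
    (hx : x ∈ D i) (hij : i ≠ j) : h.proj j x = 0 := by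
  classical
  let := DirectSum.IsInternal.chooseDecomposition D h
  exact DirectSum.decompose_of_mem_ne D hx hij

theorem IsGrading.exists_sum {D : ι → S} (h : IsGrading D) (x : M) :
    ∃ s : Finset ι, x = ∑ i ∈ s, h.proj i x := by
  classical
  let := DirectSum.IsInternal.chooseDecomposition D h
  exact ⟨_, (DirectSum.sum_support_decompose D x).symm⟩

theorem IsGrading.mem_closure {D : ι → S} (h : IsGrading D) (x : M) :
    x ∈ AddSubmonoid.closure {y : M | ∃ i, y ∈ D i} := by
  obtain ⟨s, hs⟩ := h.exists_sum x
  rw [hs]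
  exact sum_mem fun i _ => AddSubmonoid.subset_closure ⟨i, h.proj_mem i x⟩

theorem IsGrading.induction {D : ι → S} (h : IsGrading D) {p : M → Prop} (h0 : p 0)
    (hadd : ∀ x y, p x → p y → p (x + y)) (hmem : ∀ i, ∀ x ∈ D i, p x) (x : M) : p x := by
  refine AddSubmonoid.closure_induction (motive := fun y _ => p y) ?_ h0
    (fun x y _ _ hx hy => hadd x y hx hy) (h.mem_closure x)
  rintro y ⟨i, hy⟩
  exact hmem i y hy

/-- Recognising a direct sum decomposition from a family of projections. -/
theorem IsGrading.of_proj (D : ι → S) (p : ι → M →+ M)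
    (hp : ∀ i, ∀ x ∈ D i, p i x = x) (hp' : ∀ i j, i ≠ j → ∀ x ∈ D i, p j x = 0)
    (hD : ∀ x, x ∈ AddSubmonoid.closure {y : M | ∃ i, y ∈ D i}) : IsGrading D := by
  classical
  have key : ∀ (x : DirectSum ι fun i => D i) (j : ι),
      p j (DirectSum.coeAddMonoidHom D x) = x j := by
    intro x j
    induction x using DirectSum.induction_on with
    | zero => simp
    | of i y =>
      rw [DirectSum.coeAddMonoidHom_of]
      by_cases hij : i = j
      · subst hij
        rw [DirectSum.of_eq_same, hp _ _ y.2]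
      · rw [DirectSum.of_eq_of_ne _ _ _ (Ne.symm hij), hp' _ _ hij _ y.2]
        rfl
    | add x y hx hy => simp [hx, hy]
  unfold IsGrading
  refine ⟨fun x y hxy => ?_, fun x => ?_⟩
  · apply DFinsupp.ext
    intro j
    apply Subtype.ext
    rw [← key x j, ← key y j]
    exact congrArg _ hxy
  · change x ∈ AddMonoidHom.mrange (DirectSum.coeAddMonoidHom D)
    refine AddSubmonoid.closure_le.2 ?_ (hD x)
    rintro y ⟨i, hy⟩
    exact ⟨DirectSum.of (fun i => D i) i ⟨y, hy⟩, DirectSum.coeAddMonoidHom_of D i ⟨y, hy⟩⟩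

/-- Coarsening a decomposition along a map `f` of the index sets. -/
theorem IsGrading.coarsen {κ : Type*} {D : ι → S} (h : IsGrading D) (f : ι → κ) (E : κ → S)
    (hDE : ∀ i, ∀ x ∈ D i, x ∈ E (f i))
    (hE : ∀ j, ∀ x ∈ E j, x ∈ AddSubmonoid.closure {y : M | ∃ i, f i = j ∧ y ∈ D i}) :
    IsGrading E := by
  classical
  let := DirectSum.IsInternal.chooseDecomposition D h
  let p : κ → M →+ M := fun j =>
    (DirectSum.toAddMonoid (fun i => if f i = j then AddSubmonoidClass.subtype (D i) else 0)).comp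
      (DirectSum.decomposeAddEquiv D).toAddMonoidHom
  have hp : ∀ i j, ∀ x ∈ D i, p j x = if f i = j then x else 0 := by
    intro i j x hx
    have : p j x = DirectSum.toAddMonoid
      (fun i => if f i = j then AddSubmonoidClass.subtype (D i) else 0)
        (DirectSum.decompose D x) := rfl
    rw [this, DirectSum.decompose_of_mem D hx, DirectSum.toAddMonoid_of]
    split_ifs <;> rfl
  refine IsGrading.of_proj E p ?_ ?_ ?_
  · intro j x hx
    refine AddSubmonoid.closure_induction (motive := fun y _ => p j y = y) ?_ (map_zero _) ?_ (hE j x hx)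
    · rintro y ⟨i, rfl, hy⟩
      rw [hp i _ y hy, if_pos rfl]
    · intro y z _ _ hy hz
      rw [map_add, hy, hz]
  · intro j k hjk x hx
    refine AddSubmonoid.closure_induction (motive := fun y _ => p k y = 0) ?_ (map_zero _) ?_ (hE j x hx)
    · rintro y ⟨i, rfl, hy⟩
      rw [hp i _ y hy, if_neg hjk]
    · intro y z _ _ hy hz
      rw [map_add, hy, hz, add_zero]
  · intro x
    refine AddSubmonoid.closure_mono ?_ (h.mem_closure x)
    rintro y ⟨i, hy⟩
    exact ⟨f i, hDE i y hy⟩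

end Internal

/-! ### Graded algebras -/

/-- `A = ⨁ g, 𝒜 g` is a `G`-graded `k`-algebra. -/
structure IsGradedAlgebra {k A G : Type*} [CommRing k] [Ring A] [Algebra k A] [Group G]
    (𝒜 : G → Submodule k A) : Prop where
  isGrading : IsGrading 𝒜
  one_mem : (1 : A) ∈ 𝒜 1
  mul_mem : ∀ {g g' : G} {a a' : A}, a ∈ 𝒜 g → a' ∈ 𝒜 g' → a * a' ∈ 𝒜 (g * g')

/-- The `H`-grading of `A` obtained by regrading along `φ : G →* H`: the component of degree `h`
is the sum of the components of degree `g` with `φ g = h`. -/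
def algShriek {k A G H : Type*} [CommRing k] [Ring A] [Algebra k A] [Group G] [Group H]
    (φ : G →* H) (𝒜 : G → Submodule k A) (h : H) : Submodule k A :=
  ⨆ (g : G) (_ : φ g = h), 𝒜 g

section algShriek

variable {k A G H : Type*} [CommRing k] [Ring A] [Algebra k A] [Group G] [Group H]
  (φ : G →* H) (𝒜 : G → Submodule k A)

theorem mem_algShriek {g : G} {a : A} (ha : a ∈ 𝒜 g) : a ∈ algShriek φ 𝒜 (φ g) :=
  Submodule.mem_iSup_of_mem g (Submodule.mem_iSup_of_mem rfl ha)

theorem algShriek_mem_closure {h : H} {a : A} (ha : a ∈ algShriek φ 𝒜 h) :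
    a ∈ AddSubmonoid.closure {y : A | ∃ g, φ g = h ∧ y ∈ 𝒜 g} := by
  let T : Submodule k A :=
    { AddSubmonoid.closure {y : A | ∃ g, φ g = h ∧ y ∈ 𝒜 g} with
      smul_mem' := by
        intro c x hx
        refine AddSubmonoid.closure_induction
          (motive := fun y _ => c • y ∈ AddSubmonoid.closure {y : A | ∃ g, φ g = h ∧ y ∈ 𝒜 g})
          ?_ ?_ ?_ hx
        · rintro y ⟨g, hg, hy⟩
          exact AddSubmonoid.subset_closure ⟨g, hg, (𝒜 g).smul_mem c hy⟩
        · rw [smul_zero]; exact zero_mem _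
        · intro y z _ _ hy hz
          rw [smul_add]; exact add_mem hy hz }
  have hT : algShriek φ 𝒜 h ≤ T :=
    iSup₂_le fun g hg y hy => AddSubmonoid.subset_closure ⟨g, hg, hy⟩
  exact hT ha

/-- `A` with its `H`-grading is an `H`-graded algebra. -/
theorem IsGradedAlgebra.shriek {𝒜 : G → Submodule k A} (h𝒜 : IsGradedAlgebra 𝒜) :
    IsGradedAlgebra (algShriek φ 𝒜) where
  isGrading := h𝒜.isGrading.coarsen φ _ (fun _ _ hx => mem_algShriek φ 𝒜 hx)
    (fun _ _ hx => algShriek_mem_closure φ 𝒜 hx)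
  one_mem := by
    have := mem_algShriek φ 𝒜 h𝒜.one_mem
    rwa [map_one] at this
  mul_mem := by
    intro h h' a a' ha ha'
    refine AddSubmonoid.closure_induction
      (motive := fun y _ => y * a' ∈ algShriek φ 𝒜 (h * h')) ?_ ?_ ?_ (algShriek_mem_closure φ 𝒜 ha)
    · rintro y ⟨g, rfl, hy⟩
      refine AddSubmonoid.closure_induction
        (motive := fun z _ => y * z ∈ algShriek φ 𝒜 (φ g * h')) ?_ ?_ ?_
        (algShriek_mem_closure φ 𝒜 ha')
      · rintro z ⟨g', rfl, hz⟩
        rw [← map_mul]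
        exact mem_algShriek φ 𝒜 (h𝒜.mul_mem hy hz)
      · rw [mul_zero]; exact zero_mem _
      · intro z w _ _ hz hw
        rw [mul_add]; exact add_mem hz hw
    · rw [zero_mul]; exact zero_mem _
    · intro z w _ _ hz hw
      rw [add_mul]; exact add_mem hz hw

end algShriek

/-! ### The category of graded modules -/

/-- A `G`-graded left `A`-module: a left `A`-module which is the direct sum of additive subgroups
`deg g`, with `A_g M_g' ⊆ M_gg'`. When `A` is a graded `k`-algebra the image of `k` lies in `A_1`,
so that each `deg g` is automatically a `k`-submodule. -/
structure GrMod {k A G : Type u} [CommRing k] [Ring A] [Algebra k A] [Group G]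
    (𝒜 : G → Submodule k A) : Type (u + 1) where
  carrier : Type u
  [isAddCommGroup : AddCommGroup carrier]
  [isModule : Module A carrier]
  deg : G → AddSubgroup carrier
  isGrading : IsGrading deg
  smul_mem : ∀ {g g' : G} {a : A} {m : carrier}, a ∈ 𝒜 g → m ∈ deg g' → a • m ∈ deg (g * g')

attribute [instance] GrMod.isAddCommGroup GrMod.isModule

namespace GrMod

variable {k A G : Type u} [CommRing k] [Ring A] [Algebra k A] [Group G] {𝒜 : G → Submodule k A}

instance : CoeSort (GrMod 𝒜) (Type u) := ⟨GrMod.carrier⟩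

/-- A morphism of graded modules: an `A`-linear map preserving degrees. -/
@[ext]
structure Hom (M N : GrMod 𝒜) : Type u where
  lin : M →ₗ[A] N
  map_deg : ∀ (g : G), ∀ m ∈ M.deg g, lin m ∈ N.deg g

instance : Category.{u} (GrMod 𝒜) where
  Hom := Hom
  id M := ⟨LinearMap.id, fun _ _ hm => hm⟩
  comp f f' := ⟨f'.lin.comp f.lin, fun g m hm => f'.map_deg g _ (f.map_deg g m hm)⟩

variable {M N P : GrMod 𝒜}

@[ext]
theorem hom_ext {f f' : M ⟶ N} (h : ∀ x : M, f.lin x = f'.lin x) : f = f' :=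
  Hom.ext (LinearMap.ext h)

@[simp]
theorem id_lin : (𝟙 M : M ⟶ M).lin = LinearMap.id := rfl

@[simp]
theorem comp_lin (f : M ⟶ N) (f' : N ⟶ P) : (f ≫ f').lin = f'.lin.comp f.lin := rfl

instance : Zero (M ⟶ N) := ⟨⟨0, fun g _ _ => (N.deg g).zero_mem⟩⟩

instance : Add (M ⟶ N) :=
  ⟨fun f f' => ⟨f.lin + f'.lin, fun g m hm =>
    (N.deg g).add_mem (f.map_deg g m hm) (f'.map_deg g m hm)⟩⟩

instance : Neg (M ⟶ N) :=
  ⟨fun f => ⟨-f.lin, fun g m hm => (N.deg g).neg_mem (f.map_deg g m hm)⟩⟩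

@[simp] theorem zero_lin : (0 : M ⟶ N).lin = 0 := rfl

@[simp] theorem add_lin (f f' : M ⟶ N) : (f + f').lin = f.lin + f'.lin := rfl

@[simp] theorem neg_lin (f : M ⟶ N) : (-f).lin = -f.lin := rfl

instance : AddCommGroup (M ⟶ N) where
  add_assoc f f' f'' := by ext x; simp [add_assoc]
  zero_add f := by ext x; simp
  add_zero f := by ext x; simp
  add_comm f f' := by ext x; simp [add_comm]
  neg_add_cancel f := by ext x; simp
  nsmul := nsmulRec
  zsmul := zsmulRec

instance : Preadditive (GrMod 𝒜) where
  add_comp _ _ _ f f' h := by ext x; simp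
  comp_add _ _ _ f h h' := by ext x; simp

theorem hom_proj (f : M ⟶ N) (g : G) (x : M) :
    f.lin (M.isGrading.proj g x) = N.isGrading.proj g (f.lin x) := by
  refine M.isGrading.induction (p := fun x => f.lin (M.isGrading.proj g x) =
    N.isGrading.proj g (f.lin x)) (by simp) (fun x y hx hy => by simp [hx, hy]) ?_ x
  intro i y hy
  by_cases hi : i = g
  · subst hi
    rw [M.isGrading.proj_of_mem hy, N.isGrading.proj_of_mem (f.map_deg _ _ hy)]
  · rw [M.isGrading.proj_of_mem_ne hy hi, N.isGrading.proj_of_mem_ne (f.map_deg _ _ hy) hi,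
      map_zero]

/-- A submodule of a graded module is graded if it contains the homogeneous components of its
elements. -/
def IsGradedSubmodule (M : GrMod 𝒜) (K : Submodule A M) : Prop :=
  ∀ x ∈ K, ∀ g : G, M.isGrading.proj g x ∈ K

/-- A graded submodule as a graded module. -/
def sub (M : GrMod 𝒜) (K : Submodule A M) (hK : M.IsGradedSubmodule K) : GrMod 𝒜 where
  carrier := K
  deg g := (M.deg g).comap K.subtype.toAddMonoidHom
  isGrading := by
    refine IsGrading.of_proj _
      (fun g => ((M.isGrading.proj g).comp K.subtype.toAddMonoidHom).codRestrict K
        (fun x => hK x.1 x.2 g)) ?_ ?_ ?_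
    · intro g x hx
      exact Subtype.ext (M.isGrading.proj_of_mem hx)
    · intro g g' hg x hx
      exact Subtype.ext (M.isGrading.proj_of_mem_ne hx hg)
    · intro x
      obtain ⟨s, hs⟩ := M.isGrading.exists_sum x.1
      have : x = ∑ g ∈ s, (⟨M.isGrading.proj g x.1, hK x.1 x.2 g⟩ : K) := by
        apply Subtype.ext
        rw [AddSubmonoidClass.coe_finsetSum]
        exact hs
      rw [this]
      exact sum_mem fun g _ => AddSubmonoid.subset_closure ⟨g, M.isGrading.proj_mem g x.1⟩
  smul_mem ha hm := M.smul_mem ha hm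

/-- The inclusion of a graded submodule. -/
def subι (M : GrMod 𝒜) (K : Submodule A M) (hK : M.IsGradedSubmodule K) : M.sub K hK ⟶ M :=
  Hom.mk (M := M.sub K hK) K.subtype fun _ _ hm => hm

/-- The quotient of a graded module by a graded submodule. -/
def quot (M : GrMod 𝒜) (K : Submodule A M) (hK : M.IsGradedSubmodule K) : GrMod 𝒜 where
  carrier := M ⧸ K
  deg g := (M.deg g).map K.mkQ.toAddMonoidHom
  isGrading := by
    refine IsGrading.of_proj _
      (fun g => QuotientAddGroup.lift K.toAddSubgroup
        (K.mkQ.toAddMonoidHom.comp (M.isGrading.proj g)) (fun x hx =>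
          (Submodule.Quotient.mk_eq_zero K).2 (hK x hx g))) ?_ ?_ ?_
    · rintro g _ ⟨x, hx, rfl⟩
      change K.mkQ (M.isGrading.proj g x) = K.mkQ x
      rw [M.isGrading.proj_of_mem hx]
    · rintro g g' hg _ ⟨x, hx, rfl⟩
      change K.mkQ (M.isGrading.proj g' x) = 0
      rw [M.isGrading.proj_of_mem_ne hx hg, map_zero]
    · intro x
      obtain ⟨x, rfl⟩ := K.mkQ_surjective x
      obtain ⟨s, hs⟩ := M.isGrading.exists_sum x
      rw [hs, map_sum]
      exact sum_mem fun g _ =>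
        AddSubmonoid.subset_closure ⟨g, _, M.isGrading.proj_mem g x, rfl⟩
  smul_mem := by
    rintro g g' a _ ha ⟨m, hm, rfl⟩
    exact ⟨a • m, M.smul_mem ha hm, map_smul K.mkQ a m⟩

/-- The projection to a graded quotient. -/
def quotπ (M : GrMod 𝒜) (K : Submodule A M) (hK : M.IsGradedSubmodule K) : M ⟶ M.quot K hK :=
  Hom.mk (N := M.quot K hK) K.mkQ fun _ m hm => ⟨m, hm, rfl⟩

/-- The direct product of two graded modules. -/
def prod (M N : GrMod 𝒜) : GrMod 𝒜 where
  carrier := M × N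
  deg g := (M.deg g).prod (N.deg g)
  isGrading := by
    refine IsGrading.of_proj _
      (fun g => (M.isGrading.proj g).prodMap (N.isGrading.proj g)) ?_ ?_ ?_
    · rintro g ⟨x, y⟩ ⟨hx, hy⟩
      exact Prod.ext (M.isGrading.proj_of_mem hx) (N.isGrading.proj_of_mem hy)
    · rintro g g' hg ⟨x, y⟩ ⟨hx, hy⟩
      exact Prod.ext (M.isGrading.proj_of_mem_ne hx hg) (N.isGrading.proj_of_mem_ne hy hg)
    · rintro ⟨x, y⟩
      have hxy : ((x, y) : M × N) = AddMonoidHom.inl M N x + AddMonoidHom.inr M N y := by simp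
      rw [hxy]
      refine add_mem ?_ ?_
      · obtain ⟨s, hs⟩ := M.isGrading.exists_sum x
        rw [hs, map_sum]
        exact sum_mem fun g _ =>
          AddSubmonoid.subset_closure ⟨g, M.isGrading.proj_mem g x, (N.deg g).zero_mem⟩
      · obtain ⟨s, hs⟩ := N.isGrading.exists_sum y
        rw [hs, map_sum]
        exact sum_mem fun g _ =>
          AddSubmonoid.subset_closure ⟨g, (M.deg g).zero_mem, N.isGrading.proj_mem g y⟩
  smul_mem ha hm := ⟨M.smul_mem ha hm.1, N.smul_mem ha hm.2⟩

/-- The zero graded module. -/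
def zeroObj (𝒜 : G → Submodule k A) : GrMod 𝒜 where
  carrier := PUnit
  deg _ := ⊤
  isGrading := IsGrading.of_proj _ (fun _ => 0) (fun _ _ _ => rfl) (fun _ _ _ _ _ => rfl)
    (fun _ => zero_mem _)
  smul_mem _ _ := trivial

theorem isZero_zeroObj : IsZero (zeroObj 𝒜) := by
  rw [IsZero.iff_id_eq_zero]
  ext x
  rfl

instance : HasZeroObject (GrMod 𝒜) := ⟨⟨_, isZero_zeroObj⟩⟩

theorem hasBinaryProduct (M N : GrMod 𝒜) : HasBinaryProduct M N :=
  ⟨⟨⟨BinaryFan.mk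
      (Hom.mk (M := M.prod N) (N := M) (LinearMap.fst A M N) fun _ _ h => h.1 : M.prod N ⟶ M)
      (Hom.mk (M := M.prod N) (N := N) (LinearMap.snd A M N) fun _ _ h => h.2 : M.prod N ⟶ N),
    BinaryFan.isLimitMk
      (fun s => Hom.mk (N := M.prod N) (LinearMap.prod (Hom.lin s.fst) (Hom.lin s.snd))
        fun g m hm => ⟨Hom.map_deg s.fst g m hm, Hom.map_deg s.snd g m hm⟩)
      (fun _ => rfl) (fun _ => rfl)
      (fun _ _ h₁ h₂ => hom_ext fun x =>
        Prod.ext (congrArg (fun f => Hom.lin f x) h₁) (congrArg (fun f => Hom.lin f x) h₂))⟩⟩⟩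

instance : HasFiniteProducts (GrMod 𝒜) := by
  have : HasBinaryProducts (GrMod 𝒜) :=
    have := hasBinaryProduct (𝒜 := 𝒜)
    hasBinaryProducts_of_hasLimit_pair _
  have : HasTerminal (GrMod 𝒜) := HasZeroObject.hasTerminal
  exact hasFiniteProducts_of_has_binary_and_terminal

theorem ker_isGraded (f : M ⟶ N) : M.IsGradedSubmodule (LinearMap.ker f.lin) := by
  intro x hx g
  rw [LinearMap.mem_ker] at hx ⊢
  rw [hom_proj, hx, map_zero]

theorem range_isGraded (f : M ⟶ N) : N.IsGradedSubmodule (LinearMap.range f.lin) := by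
  rintro _ ⟨x, rfl⟩ g
  exact ⟨_, hom_proj f g x⟩

/-- The inclusion of the kernel of `f` is a categorical kernel. -/
def kernelIsLimit (f : M ⟶ N) : IsLimit (KernelFork.ofι (M.subι _ (ker_isGraded f))
    (hom_ext fun x => LinearMap.mem_ker.1 x.2) : KernelFork f) :=
  KernelFork.IsLimit.ofι _ _
    (fun {W} t ht => Hom.mk (M := W) (N := M.sub _ (ker_isGraded f))
      ((Hom.lin t).codRestrict _ fun x =>
        LinearMap.mem_ker.2 (congrArg (fun f' => Hom.lin f' x) ht)) fun g m hm => t.map_deg g m hm)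
    (fun _ _ => rfl)
    (fun _ _ _ hb => hom_ext fun x => Subtype.ext (congrArg (fun f' => Hom.lin f' x) hb))

/-- The projection to the quotient by the range of `f` is a categorical cokernel. -/
def cokernelIsColimit (f : M ⟶ N) : IsColimit (CokernelCofork.ofπ (N.quotπ _ (range_isGraded f))
    (hom_ext fun x => (Submodule.Quotient.mk_eq_zero _).2 ⟨x, rfl⟩) : CokernelCofork f) :=
  CokernelCofork.IsColimit.ofπ _ _
    (fun {W} t ht => Hom.mk (M := N.quot _ (range_isGraded f)) (N := W)
      (Submodule.liftQ _ (Hom.lin t) (by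
        rintro _ ⟨x, rfl⟩
        exact congrArg (fun f' => Hom.lin f' x) ht))
      (by
        rintro g _ ⟨m, hm, rfl⟩
        exact t.map_deg g m hm))
    (fun _ _ => rfl)
    (fun _ _ _ hb => hom_ext fun x => by
      obtain ⟨y, rfl⟩ := Submodule.mkQ_surjective _ x
      exact congrArg (fun f' => Hom.lin f' y) hb)

instance : HasKernels (GrMod 𝒜) := ⟨fun f => ⟨⟨⟨_, kernelIsLimit f⟩⟩⟩⟩

instance : HasCokernels (GrMod 𝒜) := ⟨fun f => ⟨⟨⟨_, cokernelIsColimit f⟩⟩⟩⟩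

theorem injective_of_mono (f : M ⟶ N) [Mono f] : Function.Injective f.lin := by
  rw [← LinearMap.ker_eq_bot, eq_bot_iff]
  intro x hx
  have h : M.subι _ (ker_isGraded f) = 0 := by
    rw [← cancel_mono f, zero_comp]
    exact hom_ext fun x => LinearMap.mem_ker.1 x.2
  exact congrArg (fun f' => Hom.lin f' (⟨x, hx⟩ : LinearMap.ker f.lin)) h

theorem surjective_of_epi (f : M ⟶ N) [Epi f] : Function.Surjective f.lin := by
  intro x
  have h : N.quotπ _ (range_isGraded f) = 0 := by
    rw [← cancel_epi f, comp_zero]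
    exact hom_ext fun x => (Submodule.Quotient.mk_eq_zero _).2 ⟨x, rfl⟩
  exact (Submodule.Quotient.mk_eq_zero _).1 (congrArg (fun f' => Hom.lin f' x) h)

/-- Every monomorphism is the kernel of its cokernel. -/
@[reducible]
noncomputable def normalMono (f : M ⟶ N) [Mono f] : NormalMono f where
  Z := N.quot _ (range_isGraded f)
  g := N.quotπ _ (range_isGraded f)
  w := hom_ext fun x => (Submodule.Quotient.mk_eq_zero _).2 ⟨x, rfl⟩
  isLimit := by
    let e := LinearEquiv.ofInjective f.lin (injective_of_mono f)
    have he : ∀ y, f.lin (e.symm y) = y.1 := fun y => congrArg Subtype.val (e.apply_symm_apply y)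
    have hr : ∀ {W : GrMod 𝒜} (t : W ⟶ N), t ≫ N.quotπ _ (range_isGraded f) = 0 →
        ∀ x, t.lin x ∈ LinearMap.range f.lin := fun t ht x =>
      (Submodule.Quotient.mk_eq_zero _).1 (congrArg (fun f' => Hom.lin f' x) ht)
    refine KernelFork.IsLimit.ofι _ _
      (fun {W} t ht => Hom.mk (M := W) (N := M)
        (e.symm.toLinearMap.comp (t.lin.codRestrict _ (hr t ht))) ?_) ?_ ?_
    · intro g m hm
      set y : M := (e.symm.toLinearMap.comp (t.lin.codRestrict _ (hr t ht))) m with hy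
      have hfy : f.lin y = t.lin m := he _
      have : M.isGrading.proj g y = y := by
        apply injective_of_mono f
        rw [hom_proj, hfy, N.isGrading.proj_of_mem (t.map_deg g m hm)]
      rw [← this]
      exact M.isGrading.proj_mem g y
    · intro W t ht
      exact hom_ext fun x => he _
    · intro W t ht b hb
      refine hom_ext fun x => injective_of_mono f ?_
      exact (congrArg (fun f' => Hom.lin f' x) hb).trans (he ⟨t.lin x, hr t ht x⟩).symm

/-- Every epimorphism is the cokernel of its kernel. -/
@[reducible]
noncomputable def normalEpi (f : M ⟶ N) [Epi f] : NormalEpi f where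
  W := M.sub _ (ker_isGraded f)
  g := M.subι _ (ker_isGraded f)
  w := hom_ext fun x => LinearMap.mem_ker.1 x.2
  isColimit := by
    let e := f.lin.quotKerEquivOfSurjective (surjective_of_epi f)
    have he : ∀ x, e.symm (f.lin x) = Submodule.Quotient.mk x := fun x => by
      rw [LinearEquiv.symm_apply_eq]
      rfl
    have hk : ∀ {W : GrMod 𝒜} (t : M ⟶ W), M.subι _ (ker_isGraded f) ≫ t = 0 →
        LinearMap.ker f.lin ≤ LinearMap.ker t.lin := fun t ht x hx =>
      LinearMap.mem_ker.2 (congrArg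
        (fun f' => Hom.lin (M := M.sub _ (ker_isGraded f)) f' (⟨x, hx⟩ : LinearMap.ker f.lin)) ht)
    have hl : ∀ {W : GrMod 𝒜} (t : M ⟶ W) (ht : M.subι _ (ker_isGraded f) ≫ t = 0) (x : M),
        ((Submodule.liftQ _ t.lin (hk t ht)).comp e.symm.toLinearMap) (f.lin x) = t.lin x := by
      intro W t ht x
      exact (congrArg (Submodule.liftQ _ t.lin (hk t ht)) (he x)).trans rfl
    refine CokernelCofork.IsColimit.ofπ _ _
      (fun {W} t ht => Hom.mk (M := N) (N := W)
        ((Submodule.liftQ _ t.lin (hk t ht)).comp e.symm.toLinearMap) ?_) ?_ ?_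
    · intro g m hm
      obtain ⟨x, rfl⟩ := surjective_of_epi f m
      rw [← N.isGrading.proj_of_mem hm, ← hom_proj, hl t ht]
      exact t.map_deg g _ (M.isGrading.proj_mem g x)
    · intro W t ht
      exact hom_ext fun x => hl t ht x
    · intro W t ht b hb
      refine hom_ext fun y => ?_
      obtain ⟨x, rfl⟩ := surjective_of_epi f y
      exact (congrArg (fun f' => Hom.lin f' x) hb).trans (hl t ht x).symm

/-- The category `Gr_G A` of `G`-graded `A`-modules is abelian. -/
noncomputable instance : Abelian (GrMod 𝒜) where
  normalMonoOfMono f _ := ⟨normalMono f⟩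
  normalEpiOfEpi f _ := ⟨normalEpi f⟩

end GrMod

/-- `A` is left `G`-graded noetherian: every graded submodule of a finitely generated graded
`A`-module is finitely generated. -/
def IsGradedLeftNoetherian {k A G : Type u} [CommRing k] [Ring A] [Algebra k A] [Group G]
    (𝒜 : G → Submodule k A) : Prop :=
  ∀ M : GrMod 𝒜, Module.Finite A M → ∀ K : Submodule A M, M.IsGradedSubmodule K → K.FG

/-! ### Change of grading -/

section Shriek

variable {k A G H : Type u} [CommRing k] [Ring A] [Algebra k A] [Group G] [Group H]
  {𝒜 : G → Submodule k A} (φ : G →* H)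

/-- The component of degree `h` of `φ_! M`, namely the sum of the `M_g` with `φ g = h`. -/
def degShriek (M : GrMod 𝒜) (h : H) : AddSubgroup M :=
  ⨆ (g : G) (_ : φ g = h), M.deg g

theorem mem_degShriek (M : GrMod 𝒜) {g : G} {x : M} (hx : x ∈ M.deg g) :
    x ∈ degShriek φ M (φ g) :=
  AddSubgroup.mem_iSup_of_mem g (AddSubgroup.mem_iSup_of_mem rfl hx)

theorem degShriek_mem_closure (M : GrMod 𝒜) {h : H} {x : M} (hx : x ∈ degShriek φ M h) :
    x ∈ AddSubmonoid.closure {y : M | ∃ g, φ g = h ∧ y ∈ M.deg g} := by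
  let T : AddSubgroup M :=
    { AddSubmonoid.closure {y : M | ∃ g, φ g = h ∧ y ∈ M.deg g} with
      neg_mem' := by
        intro x hx
        refine AddSubmonoid.closure_induction
          (motive := fun y _ => -y ∈ AddSubmonoid.closure {y : M | ∃ g, φ g = h ∧ y ∈ M.deg g})
          ?_ ?_ ?_ hx
        · rintro y ⟨g, hg, hy⟩
          exact AddSubmonoid.subset_closure ⟨g, hg, (M.deg g).neg_mem hy⟩
        · rw [neg_zero]; exact zero_mem _
        · intro y z _ _ hy hz
          rw [neg_add]; exact add_mem hy hz }
  have hT : degShriek φ M h ≤ T :=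
    iSup₂_le fun g hg y hy => AddSubmonoid.subset_closure ⟨g, hg, hy⟩
  exact hT hx

/-- The `H`-graded module `φ_! M`: the same `A`-module as `M`, regraded along `φ`. -/
def shriekObj (M : GrMod 𝒜) : GrMod (algShriek φ 𝒜) where
  carrier := M
  deg := degShriek φ M
  isGrading := M.isGrading.coarsen φ _ (fun _ _ hx => mem_degShriek φ M hx)
    (fun _ _ hx => degShriek_mem_closure φ M hx)
  smul_mem := by
    intro h h' a m ha hm
    refine AddSubmonoid.closure_induction
      (motive := fun y _ => y • m ∈ degShriek φ M (h * h')) ?_ ?_ ?_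
      (algShriek_mem_closure φ 𝒜 ha)
    · rintro y ⟨g, rfl, hy⟩
      refine AddSubmonoid.closure_induction
        (motive := fun z _ => y • z ∈ degShriek φ M (φ g * h')) ?_ ?_ ?_
        (degShriek_mem_closure φ M hm)
      · rintro z ⟨g', rfl, hz⟩
        rw [← map_mul]
        exact mem_degShriek φ M (M.smul_mem hy hz)
      · rw [smul_zero]; exact zero_mem _
      · intro z w _ _ hz hw
        rw [smul_add]; exact add_mem hz hw
    · rw [zero_smul]; exact zero_mem _
    · intro z w _ _ hz hw
      rw [add_smul]; exact add_mem hz hw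

/-- The push-down functor `φ_! : Gr_G A ⥤ Gr_H A`; it does not change underlying maps. -/
def shriek (φ : G →* H) : GrMod 𝒜 ⥤ GrMod (algShriek φ 𝒜) where
  obj M := shriekObj φ M
  map {M N} f := GrMod.Hom.mk (M := shriekObj φ M) (N := shriekObj φ N) (GrMod.Hom.lin (M := M) (N := N) f) (by
    intro h m hm
    refine AddSubmonoid.closure_induction
      (motive := fun y _ => GrMod.Hom.lin (M := M) (N := N) f y ∈ degShriek φ N h) ?_ ?_ ?_
      (degShriek_mem_closure φ M hm)
    · rintro y ⟨g, rfl, hy⟩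
      exact mem_degShriek φ N (f.map_deg g y hy)
    · rw [map_zero]; exact zero_mem _
    · intro z w _ _ hz hw
      rw [map_add]; exact add_mem hz hw)

end Shriek

/-- The projective dimension of the trivial `k[L]`-module `k`. -/
noncomputable def trivialProjDim (k L : Type u) [CommRing k] [Group L] : WithBot ℕ∞ :=
  projectiveDimension
    (ModuleCat.of.{u} (MonoidAlgebra k L) (Representation.trivial k L k).asModule)

end GroupGraded

/-!
The lower bound comes from the right adjoint `φ^*` of `φ_!` (`upperStar`), with
`(φ^* N)_g = N_{φ g}`. It is exact (`upperStar_shortExact`), and it preserves injectives because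
`φ_!` is exact, so it does not increase injective dimension. Since `φ^* φ_! M` is the direct sum
of the shifts `M[l]` for `l ∈ ker φ`, it contains `M` as a direct summand
(`retractUpperStarShriek`).

For the upper bound, dimension shifting along injective resolutions reduces to the claim that
`N = φ_! I` has injective dimension at most `projdim k` when `I` is injective. Noetherianity
enters once: `φ^* N` is a direct sum of shifts of `I`, and it is injective by a graded Baer
criterion, as graded left ideals are finitely generated (`injective_upperStar_shriek`).

The group `L = ker φ` acts by right translation on functions `φ⁻¹(h) → N_h`. For a `k[L]`-module
`V` let `T(V)` (`coindHom`) be the `H`-graded module with components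
`T(V)_h = Hom_{k[L]}(V, Map(φ⁻¹(h), N_h))`. Three facts give the bound.
* A morphism `X ⟶ T(V)` is a `k[L]`-linear map from `V` to `Hom(φ^* X, φ^* N)`
  (`fibreMaps`). The latter is exact in `X` because `φ^* N` is injective, so `T(V)` is injective
  whenever `V` is projective (`injective_coindHom`).
* `T` turns exact sequences which split over `k` into exact sequences (`coindHom_shortExact`).
  A surjection onto a `k[L]`-module which is projective over `k` is of this kind, and its kernel is
  again projective over `k` if its source is. Hence the injective dimension of `T(V)` is at most
  the projective dimension of `V` for every `V` that is projective over `k`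
  (`hasInjectiveDimensionLT_coindHom`).
* `L`-invariant functions on a fibre are constant, so `T(k)` is `N` (`isIso_constHom`); here it
  matters that `N` is supported on the image of `φ`.

Graded modules are built as submodules of an ambient `A`-module spanned by a family of independent
subgroups (`ofFamily`). For `φ^*` the ambient module consists of functions on `G`, on which
`a ∈ A_g` acts by `(a • F) x = a • F (g⁻¹ * x)` (`Coind`); for `T(V)` it consists of the `k[L]`-linear maps
from `V` to such functions.
-/

/-! ### Additive maps out of a direct sum decomposition -/

namespace GroupGraded

section Internal

variable {ι M S T : Type*} [AddCommGroup M] [SetLike S M] [AddSubmonoidClass S M]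
  [AddCommMonoid T]

/-- The additive map which agrees with `f i` on the component `D i`. -/
noncomputable def IsGrading.lift {D : ι → S} (h : IsGrading D) (f : ι → M →+ T) : M →+ T := by
  classical
  letI := DirectSum.IsInternal.chooseDecomposition D h
  exact (DirectSum.toAddMonoid fun i => (f i).comp (AddSubmonoidClass.subtype (D i))).comp
    (DirectSum.decomposeAddEquiv D).toAddMonoidHom

theorem IsGrading.lift_of_mem {D : ι → S} (h : IsGrading D) (f : ι → M →+ T) {i : ι} {x : M}
    (hx : x ∈ D i) : h.lift f x = f i x := by
  classical
  let := DirectSum.IsInternal.chooseDecomposition D h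
  have : h.lift f x = DirectSum.toAddMonoid
      (fun i => (f i).comp (AddSubmonoidClass.subtype (D i))) (DirectSum.decompose D x) := rfl
  rw [this, DirectSum.decompose_of_mem D hx, DirectSum.toAddMonoid_of]
  rfl

theorem IsGrading.eq_zero_of_proj {D : ι → S} (h : IsGrading D) {x : M}
    (hx : ∀ i, h.proj i x = 0) : x = 0 := by
  obtain ⟨s, hs⟩ := h.exists_sum x
  rw [hs]
  exact Finset.sum_eq_zero fun i _ => hx i

end Internal

/-! ### Graded modules and their homogeneous components -/

namespace GrMod

variable {k A G : Type u} [CommRing k] [Ring A] [Algebra k A] [Group G] {𝒜 : G → Submodule k A}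

/-- The scalars in `k` act on a graded module through `k → A`. -/
instance (M : GrMod 𝒜) : Module k M := Module.compHom M (algebraMap k A)

instance (M : GrMod 𝒜) : IsScalarTower k A M where
  smul_assoc c a m := by
    rw [Algebra.smul_def, mul_smul]
    rfl

theorem algebraMap_mem_one (h𝒜 : IsGradedAlgebra 𝒜) (c : k) : algebraMap k A c ∈ 𝒜 1 := by
  rw [Algebra.algebraMap_eq_smul_one]
  exact (𝒜 1).smul_mem c h𝒜.one_mem

theorem scalar_smul_mem (h𝒜 : IsGradedAlgebra 𝒜) (M : GrMod 𝒜) {g : G} (c : k) {m : M}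
    (hm : m ∈ M.deg g) : c • m ∈ M.deg g := by
  have := M.smul_mem (algebraMap_mem_one h𝒜 c) hm
  rw [one_mul] at this
  exact this

/-- An additive map between `A`-modules which commutes with homogeneous scalars is `A`-linear. -/
def linOfHomog {k A G : Type*} [CommRing k] [Ring A] [Algebra k A] [Group G]
    {𝒜 : G → Submodule k A} (h𝒜 : IsGradedAlgebra 𝒜) {W W' : Type*} [AddCommGroup W] [Module A W]
    [AddCommGroup W'] [Module A W'] (f : W →+ W')
    (hf : ∀ g, ∀ a ∈ 𝒜 g, ∀ m, f (a • m) = a • f m) : W →ₗ[A] W' where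
  toFun := f
  map_add' := map_add f
  map_smul' a m := h𝒜.isGrading.induction (p := fun a => f (a • m) = a • f m) (by simp)
    (fun x y hx hy => by simp [add_smul, hx, hy]) (fun g a ha => hf g a ha m) a

theorem proj_smul (M : GrMod 𝒜) {g : G} {a : A} (ha : a ∈ 𝒜 g) (g' : G)
    (m : M) : M.isGrading.proj g' (a • m) = a • M.isGrading.proj (g⁻¹ * g') m := by
  refine M.isGrading.induction (p := fun m => M.isGrading.proj g' (a • m) =
    a • M.isGrading.proj (g⁻¹ * g') m) (by simp) (fun x y hx hy => by simp [hx, hy]) ?_ m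
  intro i x hx
  by_cases h : g * i = g'
  · subst h
    rw [M.isGrading.proj_of_mem (M.smul_mem ha hx), inv_mul_cancel_left,
      M.isGrading.proj_of_mem hx]
  · rw [M.isGrading.proj_of_mem_ne (M.smul_mem ha hx) h, M.isGrading.proj_of_mem_ne hx, smul_zero]
    rintro rfl
    simp at h

theorem proj_smul_of_mem (h𝒜 : IsGradedAlgebra 𝒜) (M : GrMod 𝒜) {g : G} {m : M} (hm : m ∈ M.deg g)
    (g' : G) (a : A) :
    M.isGrading.proj g' (a • m) = h𝒜.isGrading.proj (g' * g⁻¹) a • m := by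
  refine h𝒜.isGrading.induction (p := fun a => M.isGrading.proj g' (a • m) =
    h𝒜.isGrading.proj (g' * g⁻¹) a • m) (by simp)
    (fun x y hx hy => by simp [add_smul, hx, hy]) ?_ a
  intro i x hx
  by_cases h : i * g = g'
  · subst h
    rw [M.isGrading.proj_of_mem (M.smul_mem hx hm), mul_inv_cancel_right,
      h𝒜.isGrading.proj_of_mem hx]
  · rw [M.isGrading.proj_of_mem_ne (M.smul_mem hx hm) h, h𝒜.isGrading.proj_of_mem_ne hx, zero_smul]
    rintro rfl
    simp at h

theorem proj_eq_zero_of_mem_degShriek {H : Type u} [Group H] (φ : G →* H) (M : GrMod 𝒜)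
    {h : H} {x : M} (hx : x ∈ degShriek φ M h) {g : G} (hg : φ g ≠ h) : M.isGrading.proj g x = 0 := by
  refine AddSubmonoid.closure_induction (motive := fun y _ => M.isGrading.proj g y = 0) ?_
    (map_zero _) ?_ (degShriek_mem_closure φ M hx)
  · rintro y ⟨g', rfl, hy⟩
    exact M.isGrading.proj_of_mem_ne hy (by rintro rfl; exact hg rfl)
  · intro y z _ _ hy hz
    rw [map_add, hy, hz, add_zero]

/-- A component of `φ_! M` whose degree is not in the image of `φ` is zero. -/
theorem eq_zero_of_mem_degShriek {H : Type u} [Group H] (φ : G →* H) (M : GrMod 𝒜) {h : H} {x : M}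
    (hx : x ∈ degShriek φ M h) (hh : ∀ g, φ g ≠ h) : x = 0 :=
  M.isGrading.eq_zero_of_proj fun g => proj_eq_zero_of_mem_degShriek φ M hx (hh g)

/-! ### Short exact sequences of graded modules -/

variable {M N : GrMod 𝒜}

theorem mono_of_injective (f : M ⟶ N) (hf : Function.Injective f.lin) : Mono f :=
  ⟨fun _ _ h => hom_ext fun x => hf (congrArg (fun f' => Hom.lin f' x) h)⟩

theorem epi_of_surjective (f : M ⟶ N) (hf : Function.Surjective f.lin) : Epi f :=
  ⟨fun _ _ h => hom_ext fun x => by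
    obtain ⟨y, rfl⟩ := hf x
    exact congrArg (fun f' => Hom.lin f' y) h⟩

/-- The inverse image of a morphism whose values lie in the range of an injective morphism. -/
noncomputable def liftInjective (f : M ⟶ N) (hf : Function.Injective f.lin) {W : GrMod 𝒜}
    (t : W ⟶ N) (ht : ∀ w, t.lin w ∈ LinearMap.range f.lin) : W ⟶ M :=
  Hom.mk (M := W) (N := M)
    ((LinearEquiv.ofInjective f.lin hf).symm.toLinearMap.comp (t.lin.codRestrict _ ht)) (by
      intro g m hm
      set y : M := ((LinearEquiv.ofInjective f.lin hf).symm.toLinearMap.comp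
        (t.lin.codRestrict _ ht)) m with hy
      have hfy : f.lin y = t.lin m :=
        congrArg Subtype.val ((LinearEquiv.ofInjective f.lin hf).apply_symm_apply _)
      have : M.isGrading.proj g y = y := by
        apply hf
        rw [hom_proj, hfy, N.isGrading.proj_of_mem (t.map_deg g m hm)]
      rw [← this]
      exact M.isGrading.proj_mem g y)

theorem liftInjective_comp (f : M ⟶ N) (hf : Function.Injective f.lin) {W : GrMod 𝒜}
    (t : W ⟶ N) (ht : ∀ w, t.lin w ∈ LinearMap.range f.lin) : liftInjective f hf t ht ≫ f = t :=
  hom_ext fun _ => congrArg Subtype.val ((LinearEquiv.ofInjective f.lin hf).apply_symm_apply _)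

theorem injective_of_homogeneous (f : M ⟶ N) (hf : ∀ g, ∀ x ∈ M.deg g, f.lin x = 0 → x = 0) :
    Function.Injective f.lin := by
  rw [injective_iff_map_eq_zero]
  intro x hx
  refine M.isGrading.eq_zero_of_proj fun g => hf g _ (M.isGrading.proj_mem g x) ?_
  rw [hom_proj, hx, map_zero]

theorem surjective_of_homogeneous (f : M ⟶ N) (hf : ∀ g, ∀ x ∈ N.deg g, ∃ y, f.lin y = x) :
    Function.Surjective f.lin := by
  intro x
  refine N.isGrading.induction (p := fun x => ∃ y, f.lin y = x) ⟨0, map_zero _⟩ ?_ hf x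
  rintro _ _ ⟨y, rfl⟩ ⟨z, rfl⟩
  exact ⟨y + z, map_add _ _ _⟩

/-- Short exactness of a sequence of graded modules may be checked on homogeneous elements. -/
theorem shortExact_of_homogeneous (S : ShortComplex (GrMod 𝒜))
    (h₁ : ∀ g, ∀ x ∈ S.X₁.deg g, S.f.lin x = 0 → x = 0)
    (h₂ : ∀ g, ∀ x ∈ S.X₂.deg g, S.g.lin x = 0 → ∃ y, S.f.lin y = x)
    (h₃ : ∀ g, ∀ x ∈ S.X₃.deg g, ∃ y, S.g.lin y = x) : S.ShortExact := by
  have hf := injective_of_homogeneous S.f h₁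
  have := mono_of_injective S.f hf
  have := epi_of_surjective S.g (surjective_of_homogeneous S.g h₃)
  have hex : ∀ x : S.X₂, S.g.lin x = 0 → x ∈ LinearMap.range S.f.lin := by
    intro x hx
    obtain ⟨s, hs⟩ := S.X₂.isGrading.exists_sum x
    rw [hs]
    refine sum_mem fun g _ => ?_
    obtain ⟨y, hy⟩ := h₂ g _ (S.X₂.isGrading.proj_mem g x) (by rw [hom_proj, hx, map_zero])
    exact ⟨y, hy⟩
  refine { exact := ?_ }
  rw [ShortComplex.exact_iff_exact_up_to_refinements]
  intro W t ht
  have ht' : ∀ w, t.lin w ∈ LinearMap.range S.f.lin := fun w =>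
    hex _ (congrArg (fun f' => Hom.lin f' w) ht)
  exact ⟨W, 𝟙 W, inferInstance, liftInjective S.f hf t ht', by
    rw [Category.id_comp, liftInjective_comp]⟩

/-- The sequence `0 ⟶ M ⟶ N ⟶ N / M ⟶ 0` attached to a morphism `M ⟶ N`. -/
abbrev quotSeq (f : M ⟶ N) : ShortComplex (GrMod 𝒜) :=
  ShortComplex.mk f (N.quotπ _ (range_isGraded f))
    (hom_ext fun x => (Submodule.Quotient.mk_eq_zero _).2 ⟨x, rfl⟩)

theorem quotSeq_exact (f : M ⟶ N) (x : N) (hx : (N.quotπ _ (range_isGraded f)).lin x = 0) :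
    ∃ y, f.lin y = x :=
  (Submodule.Quotient.mk_eq_zero _).1 hx

theorem shortExact_quotSeq (f : M ⟶ N) [Mono f] : (quotSeq f).ShortExact :=
  shortExact_of_homogeneous _
    (fun _ _ _ hx => injective_of_mono f (hx.trans (map_zero _).symm))
    (fun _ x _ hx => quotSeq_exact f x hx)
    (fun _ x _ => Submodule.mkQ_surjective _ x)

/-! ### Graded modules generated by a family of subgroups -/

section OfFamily

variable {W : Type u} [AddCommGroup W] [Module A W]

/-- The graded module `⨁ g, D g` attached to a family of independent subgroups `D g` of an
`A`-module `W` with `A_g D_g' ⊆ D_gg'`. Independence is witnessed by projections `p g`. -/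
def ofFamily (h𝒜 : IsGradedAlgebra 𝒜) (D : G → AddSubgroup W) (p : G → W →+ W)
    (hp : ∀ g, ∀ x ∈ D g, p g x = x) (hp' : ∀ g g', g ≠ g' → ∀ x ∈ D g, p g' x = 0)
    (hD : ∀ g g' a x, a ∈ 𝒜 g → x ∈ D g' → a • x ∈ D (g * g')) : GrMod 𝒜 :=
  let K : Submodule A W :=
    { AddSubmonoid.closure {y : W | ∃ g, y ∈ D g} with
      smul_mem' := by
        intro a x hx
        refine AddSubmonoid.closure_induction
          (motive := fun y _ => a • y ∈ AddSubmonoid.closure {y : W | ∃ g, y ∈ D g}) ?_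
          (by rw [smul_zero]; exact zero_mem _)
          (fun y z _ _ hy hz => by rw [smul_add]; exact add_mem hy hz) hx
        rintro y ⟨g, hy⟩
        refine h𝒜.isGrading.induction
          (p := fun a => a • y ∈ AddSubmonoid.closure {y : W | ∃ g, y ∈ D g})
          (by rw [zero_smul]; exact zero_mem _)
          (fun y z hy hz => by rw [add_smul]; exact add_mem hy hz) ?_ a
        exact fun g' a ha => AddSubmonoid.subset_closure ⟨_, hD g' g a y ha hy⟩ }
  have hpK : ∀ g, ∀ x ∈ K, p g x ∈ K := by
    intro g x hx
    refine AddSubmonoid.closure_induction (motive := fun y _ => p g y ∈ K) ?_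
      (by rw [map_zero]; exact zero_mem _)
      (fun y z _ _ hy hz => by rw [map_add]; exact add_mem hy hz) hx
    rintro y ⟨g', hy⟩
    by_cases h : g' = g
    · subst h
      rw [hp _ y hy]
      exact AddSubmonoid.subset_closure ⟨_, hy⟩
    · rw [hp' _ _ h y hy]
      exact zero_mem _
  { carrier := K
    deg := fun g => (D g).comap K.subtype.toAddMonoidHom
    isGrading := by
      refine IsGrading.of_proj _
        (fun g => ((p g).comp K.subtype.toAddMonoidHom).codRestrict K
          fun x => hpK g x.1 x.2) ?_ ?_ ?_
      · exact fun g x hx => Subtype.ext (hp g x.1 hx)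
      · exact fun g g' hg x hx => Subtype.ext (hp' g g' hg x.1 hx)
      · rintro ⟨x, hx⟩
        refine AddSubmonoid.closure_induction (motive := fun y hy =>
          (⟨y, hy⟩ : K) ∈ AddSubmonoid.closure
            {y : K | ∃ g, y ∈ (D g).comap K.subtype.toAddMonoidHom}) ?_ (zero_mem _)
          (fun y z _ _ hy hz => add_mem hy hz) hx
        rintro y ⟨g, hy⟩
        exact AddSubmonoid.subset_closure ⟨g, hy⟩
    smul_mem := fun {g g' a m} ha hm => hD g g' a m.1 ha hm }

variable {h𝒜 : IsGradedAlgebra 𝒜} {D : G → AddSubgroup W} {p : G → W →+ W}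
    {hp : ∀ g, ∀ x ∈ D g, p g x = x} {hp' : ∀ g g', g ≠ g' → ∀ x ∈ D g, p g' x = 0}
    {hD : ∀ g g' a x, a ∈ 𝒜 g → x ∈ D g' → a • x ∈ D (g * g')}

/-- The inclusion of `⨁ g, D g` into the ambient module. -/
def famι : ofFamily h𝒜 D p hp hp' hD →ₗ[A] W := Submodule.subtype _

theorem famι_injective : Function.Injective (famι (h𝒜 := h𝒜) (hp := hp) (hp' := hp') (hD := hD)) :=
  Subtype.val_injective

/-- An element of `D g` as an element of `⨁ g, D g`. -/
def famMk (g : G) (x : W) (hx : x ∈ D g) : ofFamily h𝒜 D p hp hp' hD :=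
  ⟨x, AddSubmonoid.subset_closure ⟨g, hx⟩⟩

/-- A linear map to the ambient module which respects degrees, as a morphism to `⨁ g, D g`. -/
def toFamily {X : GrMod 𝒜} (u : X →ₗ[A] W) (hu : ∀ g, ∀ x ∈ X.deg g, u x ∈ D g) :
    X ⟶ ofFamily h𝒜 D p hp hp' hD :=
  Hom.mk (M := X) (N := ofFamily h𝒜 D p hp hp' hD)
    (u.codRestrict _ fun x => X.isGrading.induction
      (p := fun x => u x ∈ AddSubmonoid.closure {y : W | ∃ g, y ∈ D g})
      (by rw [map_zero]; exact zero_mem _)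
      (fun y z hy hz => by rw [map_add]; exact add_mem hy hz)
      (fun g x hx => AddSubmonoid.subset_closure ⟨g, hu g x hx⟩) x)
    fun g x hx => hu g x hx

end OfFamily

end GrMod

end GroupGraded

/-! ### The module of functions on the grading group -/

namespace GroupGraded

/-- The additive group of functions `G → E`, on which a homogeneous `a ∈ A_g` acts by
`(a • F) x = a • F (g⁻¹ * x)`. The grading of `A` is part of the type since the action depends
on it. -/
def Coind {k A G : Type*} [CommRing k] [Ring A] [Algebra k A] [Group G] {𝒜 : G → Submodule k A}
    (_h𝒜 : IsGradedAlgebra 𝒜) (E : Type*) : Type _ := G → E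

namespace Coind

variable {k A G : Type*} [CommRing k] [Ring A] [Algebra k A] [Group G] {𝒜 : G → Submodule k A}
  {h𝒜 : IsGradedAlgebra 𝒜} {E : Type*}

@[ext]
theorem ext {F F' : Coind h𝒜 E} (h : ∀ x : G, F x = F' x) : F = F' := funext h

variable [AddCommGroup E]

instance : AddCommGroup (Coind h𝒜 E) := inferInstanceAs (AddCommGroup (G → E))

@[simp] theorem zero_apply (x : G) : (0 : Coind h𝒜 E) x = 0 := rfl

@[simp] theorem add_apply (F F' : Coind h𝒜 E) (x : G) : (F + F') x = F x + F' x := rfl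

/-- Evaluation at an element of the group. -/
def eval (x : G) : Coind h𝒜 E →+ E := Pi.evalAddMonoidHom _ x

open scoped Classical in
/-- The function with value `e` at `x` and zero elsewhere. -/
noncomputable def single (x : G) : E →+ Coind h𝒜 E := AddMonoidHom.single (fun _ : G => E) x

@[simp]
theorem single_same (x : G) (e : E) : (single x e : Coind h𝒜 E) x = e := by
  classical exact Pi.single_eq_same (M := fun _ : G => E) x e

theorem single_ne {x y : G} (h : y ≠ x) (e : E) : (single x e : Coind h𝒜 E) y = 0 := by
  classical exact Pi.single_eq_of_ne (M := fun _ : G => E) h e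

variable [Module A E]

variable (h𝒜 E) in
/-- The action of `A`, as an additive map. -/
noncomputable def act : A →+ (Coind h𝒜 E →+ Coind h𝒜 E) :=
  h𝒜.isGrading.lift fun g =>
    { toFun := fun a =>
        { toFun := fun F x => a • F (g⁻¹ * x)
          map_zero' := by ext x; simp
          map_add' := fun F F' => by ext x; exact smul_add a _ _ }
      map_zero' := by
        refine AddMonoidHom.ext fun F => ?_
        ext x
        exact zero_smul A _
      map_add' := fun a a' => by
        refine AddMonoidHom.ext fun F => ?_
        ext x
        exact add_smul a a' _ }

theorem act_of_mem {g : G} {a : A} (ha : a ∈ 𝒜 g) (F : Coind h𝒜 E) (x : G) :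
    act h𝒜 E a F x = a • F (g⁻¹ * x) := by
  rw [act, h𝒜.isGrading.lift_of_mem _ ha]
  rfl

theorem act_mul (a a' : A) : act h𝒜 E (a * a') = (act h𝒜 E a).comp (act h𝒜 E a') := by
  refine h𝒜.isGrading.induction (p := fun a => act h𝒜 E (a * a') = (act h𝒜 E a).comp (act h𝒜 E a'))
    (by simp) (fun x y hx hy => by
      rw [add_mul, map_add, map_add, hx, hy, AddMonoidHom.add_comp]) ?_ a
  intro g a ha
  refine h𝒜.isGrading.induction (p := fun a' => act h𝒜 E (a * a') = (act h𝒜 E a).comp (act h𝒜 E a'))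
    (by simp) (fun x y hx hy => by
      rw [mul_add, map_add, map_add, hx, hy, AddMonoidHom.comp_add]) ?_ a'
  intro g' a' ha'
  refine AddMonoidHom.ext fun F => ?_
  ext x
  rw [act_of_mem (h𝒜.mul_mem ha ha'), AddMonoidHom.comp_apply, act_of_mem ha, act_of_mem ha',
    mul_smul, mul_inv_rev, mul_assoc]

noncomputable instance : Module A (Coind h𝒜 E) where
  smul a F := act h𝒜 E a F
  one_smul F := by
    ext x
    change act h𝒜 E 1 F x = F x
    rw [act_of_mem h𝒜.one_mem, one_smul, inv_one, one_mul]
  mul_smul a a' F := congrArg (fun f : Coind h𝒜 E →+ Coind h𝒜 E => f F) (act_mul a a')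
  smul_zero a := map_zero (act h𝒜 E a)
  smul_add a := map_add (act h𝒜 E a)
  add_smul a a' F :=
    congrArg (fun f : Coind h𝒜 E →+ Coind h𝒜 E => f F) (map_add (act h𝒜 E) a a')
  zero_smul F := congrArg (fun f : Coind h𝒜 E →+ Coind h𝒜 E => f F) (map_zero (act h𝒜 E))

theorem smul_apply {g : G} {a : A} (ha : a ∈ 𝒜 g) (F : Coind h𝒜 E) (x : G) :
    (a • F) x = a • F (g⁻¹ * x) := act_of_mem ha F x

theorem smul_single {g : G} {a : A} (ha : a ∈ 𝒜 g) (x : G) (e : E) :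
    a • (single x e : Coind h𝒜 E) = single (g * x) (a • e) := by
  ext y
  rw [smul_apply ha]
  by_cases h : y = g * x
  · subst h
    rw [inv_mul_cancel_left, single_same, single_same]
  · rw [single_ne h, single_ne, smul_zero]
    rintro rfl
    simp at h

/-- Composition with an `A`-linear map. -/
noncomputable def map {E' : Type*} [AddCommGroup E'] [Module A E'] (u : E →ₗ[A] E') :
    Coind h𝒜 E →ₗ[A] Coind h𝒜 E' :=
  GrMod.linOfHomog h𝒜
    { toFun := fun F x => u (F x)
      map_zero' := by ext x; simp
      map_add' := fun F F' => by ext x; exact map_add u _ _ }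
    fun g a ha F => by
      ext x
      change u ((a • F) x) = _
      rw [smul_apply ha, smul_apply ha, map_smul]
      rfl

end Coind

/-! ### The pullback construction -/

namespace GrMod

variable {k A G : Type u} [CommRing k] [Ring A] [Algebra k A] [Group G] {𝒜 : G → Submodule k A}
  (h𝒜 : IsGradedAlgebra 𝒜)

section Pull

variable {E : Type u} [AddCommGroup E]

/-- The functions supported at `g` with value in `B`. -/
def supportedAt (g : G) (B : AddSubgroup E) : AddSubgroup (Coind h𝒜 E) where
  carrier := {F | F g ∈ B ∧ ∀ x, x ≠ g → F x = 0}
  zero_mem' := ⟨B.zero_mem, fun _ _ => rfl⟩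
  add_mem' := fun {F F'} hF hF' => ⟨B.add_mem hF.1 hF'.1, fun x hx => by
    rw [Coind.add_apply, hF.2 x hx, hF'.2 x hx, add_zero]⟩
  neg_mem' := fun {F} hF => ⟨B.neg_mem hF.1, fun x hx => by
    change -(F x) = 0
    rw [hF.2 x hx, neg_zero]⟩

variable {h𝒜} in
theorem eq_single_of_mem_supportedAt {g : G} {B : AddSubgroup E} {F : Coind h𝒜 E}
    (hF : F ∈ supportedAt h𝒜 g B) : F = Coind.single g (F g) := by
  ext x
  by_cases h : x = g
  · subst h
    rw [Coind.single_same]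
  · rw [hF.2 x h, Coind.single_ne h]

variable {h𝒜} in
theorem single_mem_supportedAt {g : G} {B : AddSubgroup E} {e : E} (he : e ∈ B) :
    Coind.single g e ∈ supportedAt h𝒜 g B :=
  ⟨by rwa [Coind.single_same], fun _ hx => Coind.single_ne hx e⟩

variable [Module A E]

/-- For an `A`-module `E` with subgroups `B g` such that `A_g B_g' ⊆ B_gg'`, the graded module
with components `B g`. The family `B` need not be independent in `E`. -/
noncomputable def pull (E : Type u) [AddCommGroup E] [Module A E] (B : G → AddSubgroup E)
    (hB : ∀ g g' a e, a ∈ 𝒜 g → e ∈ B g' → a • e ∈ B (g * g')) : GrMod 𝒜 :=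
  ofFamily h𝒜 (fun g => supportedAt h𝒜 g (B g))
    (fun g => (Coind.single g).comp (Coind.eval g))
    (fun _ _ hF => (eq_single_of_mem_supportedAt hF).symm)
    (fun g g' hg F hF => by
      change Coind.single g' (F g') = 0
      rw [hF.2 g' hg.symm, map_zero])
    (fun g g' (a : A) F ha hF => by
      rw [eq_single_of_mem_supportedAt hF, Coind.smul_single ha]
      exact single_mem_supportedAt (hB g g' a _ ha hF.1))

variable {B : G → AddSubgroup E}
  {hB : ∀ g g' a e, a ∈ 𝒜 g → e ∈ B g' → a • e ∈ B (g * g')}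

variable {h𝒜}

/-- The underlying function of an element of `pull E B`. -/
noncomputable def pullι : pull h𝒜 E B hB →ₗ[A] Coind h𝒜 E := famι

theorem pullι_injective :
    Function.Injective (pullι : pull h𝒜 E B hB →ₗ[A] Coind h𝒜 E) := famι_injective

theorem mem_deg_pull {g : G} {F : pull h𝒜 E B hB} :
    F ∈ (pull h𝒜 E B hB).deg g ↔ pullι F ∈ supportedAt h𝒜 g (B g) := Iff.rfl

/-- The element `e` placed in degree `g`. -/
noncomputable def pullMk (g : G) (e : E) (he : e ∈ B g) : pull h𝒜 E B hB :=
  famMk g (Coind.single g e) (single_mem_supportedAt he)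

theorem pullMk_mem (g : G) (e : E) (he : e ∈ B g) :
    pullMk (h𝒜 := h𝒜) (hB := hB) g e he ∈ (pull h𝒜 E B hB).deg g :=
  mem_deg_pull.2 <| single_mem_supportedAt he

theorem pull_apply_mem (F : pull h𝒜 E B hB) (g : G) : pullι F g ∈ B g := by
  refine (pull h𝒜 E B hB).isGrading.induction (p := fun F => pullι F g ∈ B g)
    (by rw [map_zero]; exact zero_mem _)
    (fun y z hy hz => by rw [map_add]; exact add_mem hy hz) ?_ F
  intro g' F hF
  rw [mem_deg_pull] at hF
  by_cases h : g = g'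
  · subst h
    exact hF.1
  · rw [hF.2 g h]
    exact zero_mem _

/-- The graded morphism `X ⟶ pull E B` attached to a linear map to the ambient module. -/
noncomputable def intoPull {X : GrMod 𝒜} (u : X →ₗ[A] Coind h𝒜 E)
    (hu : ∀ g, ∀ x ∈ X.deg g, u x ∈ supportedAt h𝒜 g (B g)) : X ⟶ pull h𝒜 E B hB :=
  toFamily u hu

/-- The graded morphism `X ⟶ pull E B` attached to a linear map `X → E` sending `X_g` to `B g`. -/
noncomputable def toPull {X : GrMod 𝒜} (u : X →ₗ[A] E) (hu : ∀ g, ∀ x ∈ X.deg g, u x ∈ B g) :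
    X ⟶ pull h𝒜 E B hB :=
  intoPull
    (linOfHomog h𝒜
      { toFun := fun x g => u (X.isGrading.proj g x)
        map_zero' := by ext g; simp
        map_add' := fun x y => by
          ext g
          exact (congrArg u (map_add _ x y)).trans (map_add u _ _) }
      fun g a ha x => by
        ext g'
        rw [Coind.smul_apply ha]
        change u (X.isGrading.proj g' (a • x)) = a • u (X.isGrading.proj (g⁻¹ * g') x)
        rw [proj_smul X ha, map_smul])
    fun g x hx => by
      refine ⟨?_, fun g' hg' => ?_⟩
      · change u (X.isGrading.proj g x) ∈ B g
        rw [X.isGrading.proj_of_mem hx]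
        exact hu g x hx
      · change u (X.isGrading.proj g' x) = 0
        rw [X.isGrading.proj_of_mem_ne hx hg'.symm, map_zero]

theorem pullι_toPull {X : GrMod 𝒜} (u : X →ₗ[A] E) (hu : ∀ g, ∀ x ∈ X.deg g, u x ∈ B g) (x : X)
    (g : G) :
    pullι ((toPull (h𝒜 := h𝒜) (hB := hB) u hu).lin x) g = u (X.isGrading.proj g x) := rfl

/-- The linear map `X → E` attached to a graded morphism `X ⟶ pull E B`. -/
noncomputable def ofPull {X : GrMod 𝒜} (f : X ⟶ pull h𝒜 E B hB) : X →ₗ[A] E :=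
  linOfHomog h𝒜
    (X.isGrading.lift fun g =>
      (Coind.eval g).comp ((pullι.toAddMonoidHom).comp f.lin.toAddMonoidHom))
    fun g a ha x => by
      refine X.isGrading.induction (p := fun x => X.isGrading.lift _ (a • x) =
        a • X.isGrading.lift _ x) (by simp)
        (fun x y hx hy => by simp only [smul_add, map_add, hx, hy]) ?_ x
      intro g' x hx
      rw [X.isGrading.lift_of_mem _ hx, X.isGrading.lift_of_mem _ (X.smul_mem ha hx)]
      change pullι (f.lin (a • x)) (g * g') = a • pullι (f.lin x) g'
      rw [map_smul, map_smul, Coind.smul_apply ha, inv_mul_cancel_left]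

theorem ofPull_of_mem {X : GrMod 𝒜} (f : X ⟶ pull h𝒜 E B hB) {g : G} {x : X} (hx : x ∈ X.deg g) :
    ofPull f x = pullι (f.lin x) g := X.isGrading.lift_of_mem _ hx

/-- `pull E B` is injective as soon as graded linear maps to `E` extend along monomorphisms. -/
theorem injective_pull
    (hext : ∀ ⦃X Y : GrMod 𝒜⦄ (i : X ⟶ Y) [Mono i] (u : X →ₗ[A] E),
      (∀ g, ∀ x ∈ X.deg g, u x ∈ B g) →
        ∃ u' : Y →ₗ[A] E, (∀ g, ∀ y ∈ Y.deg g, u' y ∈ B g) ∧ ∀ x, u' (i.lin x) = u x) :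
    Injective (pull h𝒜 E B hB) where
  factors {X Y} f i _ := by
    obtain ⟨u', hu', h⟩ := hext i (ofPull f) fun g x hx => by
      rw [ofPull_of_mem f hx]
      exact pull_apply_mem _ _
    refine ⟨toPull u' hu', hom_ext fun x => pullι_injective ?_⟩
    ext g
    have key : ∀ g' (x : X), x ∈ X.deg g' → u' (Y.isGrading.proj g (i.lin x)) =
        pullι (f.lin x) g := by
      intro g' x hx
      by_cases hg : g' = g
      · subst hg
        rw [Y.isGrading.proj_of_mem (i.map_deg _ _ hx), h, ofPull_of_mem f hx]
      · rw [Y.isGrading.proj_of_mem_ne (i.map_deg _ _ hx) hg, map_zero,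
          (mem_deg_pull.1 (f.map_deg _ _ hx)).2 g (Ne.symm hg)]
    refine X.isGrading.induction
      (p := fun x => u' (Y.isGrading.proj g (i.lin x)) = pullι (f.lin x) g) (by simp)
      (fun y z hy hz => by simp only [map_add, hy, hz, Coind.add_apply]) key x

end Pull

theorem exists_injective_module (A : Type u) [Ring A] (M : Type u) [AddCommGroup M]
    [Module A M] : ∃ (E : Type u) (_ : AddCommGroup E) (_ : Module A E) (_ : Module.Injective A E)
      (ι : M →ₗ[A] E), Function.Injective ι := by
  let E : ModuleCat.{u} A := Injective.under (ModuleCat.of A M)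
  have : Injective (ModuleCat.of A E) := Injective.injective_under (ModuleCat.of A M)
  exact ⟨E, inferInstance, inferInstance, Module.injective_module_of_injective_object A E,
    (Injective.ι (ModuleCat.of A M)).hom, (ModuleCat.mono_iff_injective _).1 inferInstance⟩

/-- The category of graded modules has enough injectives: `M` embeds in the graded module
all of whose components are an injective `A`-module containing `M`. -/
theorem enoughInjectives (h𝒜 : IsGradedAlgebra 𝒜) : EnoughInjectives (GrMod 𝒜) where
  presentation M := by
    obtain ⟨E, _, _, _, ι, hι⟩ := exists_injective_module A M
    let f : M ⟶ pull h𝒜 E (fun _ => ⊤) (fun _ _ _ _ _ _ => AddSubgroup.mem_top _) :=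
      toPull ι fun _ _ _ => AddSubgroup.mem_top _
    have hf : Function.Injective f.lin := injective_of_homogeneous f fun g x hx h0 => by
      have h1 : pullι (f.lin x) g = ι x := by
        rw [pullι_toPull, M.isGrading.proj_of_mem hx]
      rw [h0] at h1
      exact hι (h1.symm.trans (map_zero ι).symm)
    refine ⟨⟨_, injective_pull fun X Y i _ u _ => ?_, f, mono_of_injective f hf⟩⟩
    obtain ⟨u', hu'⟩ := Module.Injective.out i.lin (injective_of_mono i) u
    exact ⟨u', fun _ _ _ => AddSubgroup.mem_top _, hu'⟩

end GrMod

end GroupGraded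

/-! ### The right adjoint of regrading and the lower bound -/

namespace GroupGraded

section Shriek

variable {k A G H : Type u} [CommRing k] [Ring A] [Algebra k A] [Group G] [Group H]
  {𝒜 : G → Submodule k A} (φ : G →* H)

open GrMod

/-- Regrading is exact. -/
theorem shriek_shortExact (S : ShortComplex (GrMod 𝒜)) (hf : Function.Injective S.f.lin)
    (hex : ∀ x : S.X₂, S.g.lin x = 0 → ∃ y, S.f.lin y = x) (hg : Function.Surjective S.g.lin)
    (h0 : (shriek φ).map S.f ≫ (shriek φ).map S.g = 0) :
    (ShortComplex.mk ((shriek φ).map S.f) ((shriek φ).map S.g) h0).ShortExact :=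
  shortExact_of_homogeneous _
    (fun _ _ _ hx => hf (hx.trans (map_zero S.f.lin).symm)) (fun _ x _ hx => hex x hx)
    (fun _ x _ => hg x)

theorem mono_shriek_map {X Y : GrMod 𝒜} (f : X ⟶ Y) [Mono f] : Mono ((shriek φ).map f) :=
  mono_of_injective _ (injective_of_mono f)

theorem isZero_shriek_obj {M : GrMod 𝒜} (hM : IsZero M) : IsZero ((shriek φ).obj M) := by
  rw [IsZero.iff_id_eq_zero] at hM ⊢
  exact hom_ext fun x => congrArg (fun f' : M ⟶ M => f'.lin x) hM

variable (h𝒜 : IsGradedAlgebra 𝒜)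

theorem smul_mem_of_deg (N : GrMod (algShriek φ 𝒜)) (g g' : G) (a : A) (n : N) (ha : a ∈ 𝒜 g)
    (hn : n ∈ N.deg (φ g')) : a • n ∈ N.deg (φ (g * g')) := by
  rw [map_mul]
  exact N.smul_mem (mem_algShriek φ 𝒜 ha) hn

/-- The right adjoint `φ^*` of `φ_!` on objects: the component of degree `g` of `φ^* N` is
`N_{φ g}`. -/
noncomputable def upperStar (N : GrMod (algShriek φ 𝒜)) : GrMod 𝒜 :=
  pull h𝒜 N (fun g => N.deg (φ g)) (smul_mem_of_deg φ N)

/-- The underlying function of an element of `φ^* N`. -/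
noncomputable def starι (N : GrMod (algShriek φ 𝒜)) : upperStar φ h𝒜 N →ₗ[A] Coind h𝒜 N :=
  pullι (hB := smul_mem_of_deg φ N)

theorem starι_injective (N : GrMod (algShriek φ 𝒜)) : Function.Injective (starι φ h𝒜 N) :=
  pullι_injective (hB := smul_mem_of_deg φ N)

variable {φ h𝒜} in
theorem mem_deg_upperStar {N : GrMod (algShriek φ 𝒜)} {g : G} {F : upperStar φ h𝒜 N} :
    F ∈ (upperStar φ h𝒜 N).deg g ↔ starι φ h𝒜 N F ∈ supportedAt h𝒜 g (N.deg (φ g)) := Iff.rfl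

variable {φ h𝒜} in
theorem starι_of_mem {N : GrMod (algShriek φ 𝒜)} {g : G} {F : upperStar φ h𝒜 N}
    (hF : F ∈ (upperStar φ h𝒜 N).deg g) :
    starι φ h𝒜 N F = Coind.single g (starι φ h𝒜 N F g) :=
  eq_single_of_mem_supportedAt (mem_deg_upperStar.1 hF)

theorem starι_apply_mem {N : GrMod (algShriek φ 𝒜)} (F : upperStar φ h𝒜 N) (g : G) :
    starι φ h𝒜 N F g ∈ N.deg (φ g) :=
  pull_apply_mem (hB := smul_mem_of_deg φ N) F g

/-- The element `n` of `N_{φ g}` placed in degree `g`. -/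
noncomputable def starMk (N : GrMod (algShriek φ 𝒜)) (g : G) (n : N) (hn : n ∈ N.deg (φ g)) :
    upperStar φ h𝒜 N :=
  pullMk (hB := smul_mem_of_deg φ N) g n hn

@[simp]
theorem starι_starMk (N : GrMod (algShriek φ 𝒜)) (g : G) (n : N) (hn : n ∈ N.deg (φ g)) :
    starι φ h𝒜 N (starMk φ h𝒜 N g n hn) = Coind.single g n := rfl

theorem starMk_mem (N : GrMod (algShriek φ 𝒜)) (g : G) (n : N) (hn : n ∈ N.deg (φ g)) :
    starMk φ h𝒜 N g n hn ∈ (upperStar φ h𝒜 N).deg g :=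
  pullMk_mem (hB := smul_mem_of_deg φ N) g n hn

/-- The functor `φ^*` on morphisms. -/
noncomputable def upperStarMap {N N' : GrMod (algShriek φ 𝒜)} (f : N ⟶ N') :
    upperStar φ h𝒜 N ⟶ upperStar φ h𝒜 N' :=
  intoPull (hB := smul_mem_of_deg φ N') ((Coind.map f.lin).comp (starι φ h𝒜 N)) fun _ _ hF =>
    ⟨f.map_deg _ _ (mem_deg_upperStar.1 hF).1, fun x hx =>
      (congrArg f.lin ((mem_deg_upperStar.1 hF).2 x hx)).trans (map_zero f.lin)⟩

variable {φ h𝒜}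

theorem starι_upperStarMap {N N' : GrMod (algShriek φ 𝒜)} (f : N ⟶ N') (F : upperStar φ h𝒜 N)
    (g : G) : starι φ h𝒜 N' ((upperStarMap φ h𝒜 f).lin F) g = f.lin (starι φ h𝒜 N F g) := rfl

theorem upperStarMap_starMk {N N' : GrMod (algShriek φ 𝒜)} (f : N ⟶ N') (g : G) (n : N)
    (hn : n ∈ N.deg (φ g)) : (upperStarMap φ h𝒜 f).lin (starMk φ h𝒜 N g n hn) =
      starMk φ h𝒜 N' g (f.lin n) (f.map_deg _ _ hn) := by
  refine starι_injective φ h𝒜 N' ?_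
  rw [starι_of_mem ((upperStarMap φ h𝒜 f).map_deg g _ (starMk_mem φ h𝒜 N g n hn)),
    starι_upperStarMap, starι_starMk, starι_starMk, Coind.single_same]

theorem eq_starMk {N : GrMod (algShriek φ 𝒜)} {g : G} {F : upperStar φ h𝒜 N}
    (hF : F ∈ (upperStar φ h𝒜 N).deg g) :
    F = starMk φ h𝒜 N g (starι φ h𝒜 N F g) (starι_apply_mem φ h𝒜 F g) :=
  starι_injective φ h𝒜 N (starι_of_mem hF)

theorem upperStarMap_comp_eq_zero {N N' N'' : GrMod (algShriek φ 𝒜)} (f : N ⟶ N') (f' : N' ⟶ N'')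
    (h : f ≫ f' = 0) : upperStarMap φ h𝒜 f ≫ upperStarMap φ h𝒜 f' = 0 :=
  hom_ext fun F => starι_injective φ h𝒜 N'' <| Coind.ext fun g => by
    rw [comp_lin, LinearMap.comp_apply, starι_upperStarMap, starι_upperStarMap, zero_lin,
      LinearMap.zero_apply, map_zero, Coind.zero_apply]
    exact congrArg (fun t : N ⟶ N'' => t.lin (starι φ h𝒜 N F g)) h

theorem injective_upperStarMap {N N' : GrMod (algShriek φ 𝒜)} (f : N ⟶ N')
    (hf : Function.Injective f.lin) : Function.Injective (upperStarMap φ h𝒜 f).lin := by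
  intro F F' h
  refine starι_injective φ h𝒜 N (Coind.ext fun g => hf ?_)
  rw [← starι_upperStarMap, ← starι_upperStarMap, h]

variable (φ h𝒜)

/-- The functor `φ^*` is exact. -/
theorem upperStar_shortExact {N J : GrMod (algShriek φ 𝒜)} (f : N ⟶ J) [Mono f] :
    (ShortComplex.mk (upperStarMap φ h𝒜 f) (upperStarMap φ h𝒜 (quotSeq f).g)
      (upperStarMap_comp_eq_zero _ _ (quotSeq f).zero)).ShortExact := by
  refine shortExact_of_homogeneous _ ?_ ?_ ?_
  · exact fun _ _ _ hx => injective_upperStarMap f (injective_of_mono f)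
      (hx.trans (map_zero (upperStarMap φ h𝒜 f).lin).symm)
  · intro g F hF hx
    have hx' : (quotSeq f).g.lin (starι φ h𝒜 J F g) = 0 := by
      have := congrArg (fun F' => starι φ h𝒜 (quotSeq f).X₃ F' g) hx
      exact this.trans (by rw [map_zero, Coind.zero_apply])
    obtain ⟨n, hn⟩ := quotSeq_exact f _ hx'
    have hn' : n ∈ N.deg (φ g) := by
      have : N.isGrading.proj (φ g) n = n := by
        apply injective_of_mono f
        rw [hom_proj, hn, J.isGrading.proj_of_mem (starι_apply_mem φ h𝒜 F g)]
      rw [← this]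
      exact N.isGrading.proj_mem _ _
    refine ⟨starMk φ h𝒜 N g n hn', (upperStarMap_starMk f g n hn').trans ?_⟩
    refine Eq.trans ?_ (eq_starMk hF).symm
    congr 1
  · intro g F hF
    obtain ⟨n, hn, hn'⟩ := starι_apply_mem φ h𝒜 F g
    refine ⟨starMk φ h𝒜 J g n hn, (upperStarMap_starMk (quotSeq f).g g n hn).trans ?_⟩
    refine Eq.trans ?_ (eq_starMk hF).symm
    congr 1

/-- A graded linear map `X → N` for the degrees `g ↦ N_{φ g}` is a morphism `φ_! X ⟶ N`. -/
def shriekHom {X : GrMod 𝒜} {N : GrMod (algShriek φ 𝒜)} (u : X →ₗ[A] N)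
    (hu : ∀ g, ∀ x ∈ X.deg g, u x ∈ N.deg (φ g)) : (shriek φ).obj X ⟶ N :=
  Hom.mk (M := (shriek φ).obj X) (N := N) u fun h x hx => by
    refine AddSubmonoid.closure_induction (motive := fun y _ => u y ∈ N.deg h) ?_
      (by rw [map_zero]; exact zero_mem _)
      (fun y z _ _ hy hz => by rw [map_add]; exact add_mem hy hz) (degShriek_mem_closure φ X hx)
    rintro y ⟨g, rfl, hy⟩
    exact hu g y hy

/-- The functor `φ^*` preserves injectives, since its left adjoint `φ_!` is exact. -/
theorem injective_upperStar (N : GrMod (algShriek φ 𝒜)) [Injective N] :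
    Injective (upperStar φ h𝒜 N) := by
  refine injective_pull fun X Y i _ u hu => ?_
  have := mono_shriek_map φ i
  let u' := Injective.factorThru (shriekHom φ u hu) ((shriek φ).map i)
  have hu' : (shriek φ).map i ≫ u' = shriekHom φ u hu := Injective.comp_factorThru _ _
  exact ⟨u'.lin, fun g y hy => u'.map_deg _ _ (mem_degShriek φ Y hy),
    fun x => congrArg (fun t : (shriek φ).obj X ⟶ N => t.lin x) hu'⟩

theorem isZero_upperStar {N : GrMod (algShriek φ 𝒜)} (hN : IsZero N) :
    IsZero (upperStar φ h𝒜 N) := by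
  rw [IsZero.iff_id_eq_zero] at hN ⊢
  refine hom_ext fun F => starι_injective φ h𝒜 N (Coind.ext fun g => ?_)
  exact congrArg (fun t : N ⟶ N => t.lin (starι φ h𝒜 N F g)) hN

theorem hasInjectiveDimensionLT_upperStar (n : ℕ) (N : GrMod (algShriek φ 𝒜))
    [HasInjectiveDimensionLT N n] : HasInjectiveDimensionLT (upperStar φ h𝒜 N) n := by
  have := enoughInjectives (h𝒜.shriek φ)
  induction n generalizing N with
  | zero =>
    rw [hasInjectiveDimensionLT_zero_iff_isZero] at *
    exact isZero_upperStar φ h𝒜 ‹_›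
  | succ n ih =>
    cases n with
    | zero =>
      rw [zero_add, ← injective_iff_hasInjectiveDimensionLT_one] at *
      exact injective_upperStar φ h𝒜 N
    | succ n =>
      have hS := shortExact_quotSeq (Injective.ι N)
      have h3 : HasInjectiveDimensionLT (quotSeq (Injective.ι N)).X₃ (n + 1) :=
        (hS.hasInjectiveDimensionLT_X₃_iff n inferInstance).2 ‹_›
      exact ((upperStar_shortExact φ h𝒜 (Injective.ι N)).hasInjectiveDimensionLT_X₃_iff n
        (injective_upperStar φ h𝒜 _)).1 (ih _)

/-- The identity map from `M` to the regraded module `φ_! M`. -/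
def shriekEquiv (M : GrMod 𝒜) : M ≃ₗ[A] (shriek φ).obj M := LinearEquiv.refl A M

theorem shriekEquiv_mem (M : GrMod 𝒜) {g : G} {x : M} (hx : x ∈ M.deg g) :
    shriekEquiv φ M x ∈ ((shriek φ).obj M).deg (φ g) := mem_degShriek φ M hx

/-- The projection to the component at `l ∈ ker φ` of `φ^* φ_! M`, which is the direct sum
over `ker φ` of the shifts `M[l]`: an element of degree `g` is sent to its part in `M_{g * l}`. It is
defined for every `l` in `G`, and vanishes if `l ∉ ker φ`. -/
noncomputable def shiftProj (M : GrMod 𝒜) (l : G) :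
    upperStar φ h𝒜 ((shriek φ).obj M) →ₗ[A] M :=
  linOfHomog h𝒜
    ((upperStar φ h𝒜 ((shriek φ).obj M)).isGrading.lift fun g =>
      (M.isGrading.proj (g * l)).comp ((shriekEquiv φ M).symm.toAddMonoidHom.comp
        ((Coind.eval g).comp (starι φ h𝒜 ((shriek φ).obj M)).toAddMonoidHom)))
    fun g a ha F => by
      refine (upperStar φ h𝒜 ((shriek φ).obj M)).isGrading.induction
        (p := fun F => IsGrading.lift _ _ (a • F) = a • IsGrading.lift _ _ F) (by simp)
        (fun x y hx hy => by simp only [smul_add, map_add, hx, hy]) ?_ F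
      intro g' F hF
      rw [IsGrading.lift_of_mem _ _ hF, IsGrading.lift_of_mem _ _ (GrMod.smul_mem _ ha hF)]
      change M.isGrading.proj (g * g' * l)
          ((shriekEquiv φ M).symm (starι φ h𝒜 _ (a • F) (g * g'))) =
        a • M.isGrading.proj (g' * l) ((shriekEquiv φ M).symm (starι φ h𝒜 _ F g'))
      rw [map_smul, Coind.smul_apply ha, inv_mul_cancel_left, map_smul, mul_assoc,
        proj_smul M ha, inv_mul_cancel_left]

variable {φ h𝒜} in
theorem shiftProj_of_mem (M : GrMod 𝒜) (l : G) {g : G} {F : upperStar φ h𝒜 ((shriek φ).obj M)}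
    (hF : F ∈ (upperStar φ h𝒜 ((shriek φ).obj M)).deg g) :
    shiftProj φ h𝒜 M l F =
      M.isGrading.proj (g * l) ((shriekEquiv φ M).symm (starι φ h𝒜 _ F g)) :=
  (upperStar φ h𝒜 ((shriek φ).obj M)).isGrading.lift_of_mem _ hF

variable {φ h𝒜} in
theorem shiftProj_mem (M : GrMod 𝒜) (l : G) {g : G} {F : upperStar φ h𝒜 ((shriek φ).obj M)}
    (hF : F ∈ (upperStar φ h𝒜 ((shriek φ).obj M)).deg g) :
    shiftProj φ h𝒜 M l F ∈ M.deg (g * l) := by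
  rw [shiftProj_of_mem M l hF]
  exact M.isGrading.proj_mem _ _

/-- The unit `M ⟶ φ^* φ_! M` of the adjunction. -/
noncomputable def starUnit (M : GrMod 𝒜) : M ⟶ upperStar φ h𝒜 ((shriek φ).obj M) :=
  toPull (hB := smul_mem_of_deg φ _) (shriekEquiv φ M).toLinearMap
    fun _ _ hx => shriekEquiv_mem φ M hx

theorem starι_starUnit (M : GrMod 𝒜) (x : M) (g : G) :
    starι φ h𝒜 _ ((starUnit φ h𝒜 M).lin x) g = shriekEquiv φ M (M.isGrading.proj g x) := rfl

/-- `M` is a direct summand of `φ^* φ_! M`. -/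
noncomputable def retractUpperStarShriek (M : GrMod 𝒜) :
    Retract M (upperStar φ h𝒜 ((shriek φ).obj M)) where
  i := starUnit φ h𝒜 M
  r := Hom.mk (shiftProj φ h𝒜 M 1) fun g F hF => by
    have := shiftProj_mem M 1 hF
    rwa [mul_one] at this
  retract := by
    refine hom_ext fun x => ?_
    change shiftProj φ h𝒜 M 1 ((starUnit φ h𝒜 M).lin x) = x
    refine M.isGrading.induction
      (p := fun x => shiftProj φ h𝒜 M 1 ((starUnit φ h𝒜 M).lin x) = x)
      (by rw [map_zero, map_zero]) (fun x y hx hy => by rw [map_add, map_add, hx, hy]) ?_ x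
    intro g x hx
    rw [shiftProj_of_mem M 1 ((starUnit φ h𝒜 M).map_deg g x hx), mul_one, starι_starUnit,
      LinearEquiv.symm_apply_apply, M.isGrading.proj_of_mem hx, M.isGrading.proj_of_mem hx]

theorem hasInjectiveDimensionLT_of_shriek (h𝒜 : IsGradedAlgebra 𝒜) (n : ℕ) (M : GrMod 𝒜)
    [HasInjectiveDimensionLT ((shriek φ).obj M) n] : HasInjectiveDimensionLT M n :=
  have := hasInjectiveDimensionLT_upperStar φ h𝒜 n ((shriek φ).obj M)
  (retractUpperStarShriek φ h𝒜 M).hasInjectiveDimensionLT n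

end Shriek

end GroupGraded

/-! ### A graded Baer criterion and noetherianity -/

namespace GroupGraded

section Baer

variable {k A G : Type u} [CommRing k] [Ring A] [Algebra k A] [Group G]
  {𝒜 : G → Submodule k A}

open GrMod

/-- The shift of `A` generated by the unit in degree `g`. -/
def shiftAlg (h𝒜 : IsGradedAlgebra 𝒜) (g : G) : GrMod 𝒜 where
  carrier := A
  deg x := (𝒜 (x * g⁻¹)).toAddSubgroup
  isGrading := by
    refine IsGrading.of_proj _ (fun x => h𝒜.isGrading.proj (x * g⁻¹)) ?_ ?_ ?_
    · exact fun x a ha => h𝒜.isGrading.proj_of_mem ha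
    · exact fun x y hxy a ha => h𝒜.isGrading.proj_of_mem_ne ha (by simpa using hxy)
    · intro a
      refine AddSubmonoid.closure_mono ?_ (h𝒜.isGrading.mem_closure a)
      rintro b ⟨x, hb⟩
      exact ⟨x * g, by simpa using hb⟩
  smul_mem := by
    intro x y a b ha hb
    have := h𝒜.mul_mem ha hb
    rwa [← mul_assoc] at this

theorem proj_shiftAlg (h𝒜 : IsGradedAlgebra 𝒜) (g x : G) (a : A) :
    (shiftAlg h𝒜 g).isGrading.proj x a = h𝒜.isGrading.proj (x * g⁻¹) a := by
  refine h𝒜.isGrading.induction (p := fun a => (shiftAlg h𝒜 g).isGrading.proj x a =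
    h𝒜.isGrading.proj (x * g⁻¹) a) ((map_zero _).trans (map_zero _).symm) ?_ ?_ a
  · intro a b ha hb
    rw [map_add, ← ha, ← hb]
    exact map_add ((shiftAlg h𝒜 g).isGrading.proj x) _ _
  · intro y a ha
    have ha' : a ∈ (shiftAlg h𝒜 g).deg (y * g) := by
      change a ∈ 𝒜 (y * g * g⁻¹)
      rwa [mul_inv_cancel_right]
    by_cases h : y = x * g⁻¹
    · subst h
      rw [h𝒜.isGrading.proj_of_mem ha]
      refine (shiftAlg h𝒜 g).isGrading.proj_of_mem ?_
      rwa [inv_mul_cancel_right] at ha'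
    · rw [h𝒜.isGrading.proj_of_mem_ne ha h]
      refine (shiftAlg h𝒜 g).isGrading.proj_of_mem_ne ha' ?_
      rintro rfl
      simp at h

/-- The unit of `A`, as an element of degree `g` of the shift. -/
def shiftOne (h𝒜 : IsGradedAlgebra 𝒜) (g : G) : shiftAlg h𝒜 g := (1 : A)

theorem shiftOne_mem (h𝒜 : IsGradedAlgebra 𝒜) (g : G) :
    shiftOne h𝒜 g ∈ (shiftAlg h𝒜 g).deg g := by
  change (1 : A) ∈ 𝒜 (g * g⁻¹)
  rw [mul_inv_cancel]
  exact h𝒜.one_mem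

theorem smul_shiftOne (h𝒜 : IsGradedAlgebra 𝒜) (g : G) (a : A) : a • shiftOne h𝒜 g = a :=
  mul_one a

/-- A left ideal is graded if it contains the homogeneous components of its elements. -/
def IsGradedIdeal (h𝒜 : IsGradedAlgebra 𝒜) (K : Submodule A A) : Prop :=
  ∀ a ∈ K, ∀ g, h𝒜.isGrading.proj g a ∈ K

/-- The Baer property for a graded module: a linear map of degree `g` from a graded left ideal
to `J` is right multiplication by an element of `J_g`. -/
def GradedBaer (h𝒜 : IsGradedAlgebra 𝒜) (J : GrMod 𝒜) : Prop :=
  ∀ (g : G) (K : Submodule A A), IsGradedIdeal h𝒜 K → ∀ ψ : K →ₗ[A] J,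
    (∀ g' (a : K), a.1 ∈ 𝒜 g' → ψ a ∈ J.deg (g' * g)) → ∃ j ∈ J.deg g, ∀ a : K, ψ a = a.1 • j

theorem gradedBaer_of_injective (h𝒜 : IsGradedAlgebra 𝒜) (J : GrMod 𝒜) [Injective J] :
    GradedBaer h𝒜 J := by
  intro g K hK ψ hψ
  let P := shiftAlg h𝒜 g
  let K' : Submodule A P := K
  have hK' : P.IsGradedSubmodule K' := by
    intro a ha x
    exact (congrArg (· ∈ K) (proj_shiftAlg h𝒜 g x a)).mpr (hK a ha _)
  let f : P.sub K' hK' ⟶ J := Hom.mk (M := P.sub K' hK') ψ fun x a ha => by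
    have := hψ (x * g⁻¹) a ha
    rwa [inv_mul_cancel_right] at this
  have : Mono (P.subι K' hK') := mono_of_injective _ Subtype.val_injective
  let e := Injective.factorThru f (P.subι K' hK')
  have he : P.subι K' hK' ≫ e = f := Injective.comp_factorThru _ _
  refine ⟨e.lin (shiftOne h𝒜 g), e.map_deg g _ (shiftOne_mem h𝒜 g), fun a => ?_⟩
  rw [← map_smul]
  refine (congrArg (fun t : P.sub K' hK' ⟶ J => t.lin a) he).symm.trans ?_
  exact congrArg e.lin (smul_shiftOne h𝒜 g a.1).symm

/-- A partial linear map between graded modules which respects degrees. -/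
def IsGradedPMap (Y J : GrMod 𝒜) (p : Y →ₗ.[A] J) : Prop :=
  Y.IsGradedSubmodule p.domain ∧ ∀ g (y : p.domain), y.1 ∈ Y.deg g → p y ∈ J.deg g

/-- The extension step in Baer's criterion: a graded partial map to `J` extends to any homogeneous
element `y`. -/
theorem exists_isGradedPMap_sup {h𝒜 : IsGradedAlgebra 𝒜} {Y J : GrMod 𝒜}
    (hJ : GradedBaer h𝒜 J) (p : Y →ₗ.[A] J) (hp : IsGradedPMap Y J p) (g : G) (y : Y)
    (hy : y ∈ Y.deg g) : ∃ q, IsGradedPMap Y J q ∧ p ≤ q ∧ y ∈ q.domain := by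
  let K : Submodule A A := p.domain.comap (LinearMap.toSpanSingleton A Y y)
  have hK : IsGradedIdeal h𝒜 K := by
    intro a ha x
    change h𝒜.isGrading.proj x a • y ∈ p.domain
    have := proj_smul_of_mem h𝒜 Y hy (x * g) a
    rw [mul_inv_cancel_right] at this
    rw [← this]
    exact hp.1 _ ha _
  -- On the ideal of those `a` with `a • y` in the domain, `a ↦ p (a • y)` has the form `a ↦ a • j`.
  obtain ⟨j, hj, hψ⟩ := hJ g K hK
    (p.toFun.comp ((LinearMap.toSpanSingleton A Y y).restrict (fun a ha => ha)))
    (fun g' a ha => hp.2 _ _ (Y.smul_mem ha hy))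
  have hpj : ∀ (a : A) (ha : a • y ∈ p.domain), p ⟨a • y, ha⟩ = a • j := fun a ha => hψ ⟨a, ha⟩
  have H : ∀ c : A, c • y = 0 → c • j = 0 := by
    intro c hc
    rw [← hpj c (by rw [hc]; exact zero_mem _)]
    have : (⟨c • y, by rw [hc]; exact zero_mem _⟩ : p.domain) = 0 := Subtype.ext hc
    rw [this, p.map_zero]
  let r : Y →ₗ.[A] J := LinearPMap.mkSpanSingleton' y j H
  have hr : ∀ (c : A) (h : c • y ∈ r.domain), r ⟨c • y, h⟩ = c • j :=
    fun c h => LinearPMap.mkSpanSingleton'_apply y j H c h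
  have hrd : ∀ z, z ∈ r.domain ↔ ∃ c : A, c • y = z := fun z => Submodule.mem_span_singleton
  have hpr : ∀ (x : p.domain) (z : r.domain), (x : Y) = z → p x = r z := by
    rintro ⟨x, hx⟩ ⟨z, hz⟩ h
    obtain ⟨c, rfl⟩ := (hrd z).1 hz
    obtain rfl : x = c • y := h
    rw [hpj, hr]
  have hdec : ∀ (x : p.domain) (c : A) (g' : G), Y.isGrading.proj g' (x.1 + c • y) =
      Y.isGrading.proj g' x.1 + h𝒜.isGrading.proj (g' * g⁻¹) c • y := fun x c g' => by
    rw [map_add, proj_smul_of_mem h𝒜 Y hy]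
  refine ⟨p.sup r hpr, ⟨?_, ?_⟩, LinearPMap.left_le_sup p r hpr,
    Submodule.mem_sup_right ((hrd y).2 ⟨1, one_smul A y⟩)⟩
  · intro z hz g'
    obtain ⟨x, hx, w, hw, rfl⟩ := Submodule.mem_sup.1 hz
    obtain ⟨c, rfl⟩ := (hrd w).1 hw
    rw [hdec ⟨x, hx⟩]
    exact add_mem (Submodule.mem_sup_left (hp.1 x hx g'))
      (Submodule.mem_sup_right ((hrd _).2 ⟨_, rfl⟩))
  · rintro g' ⟨z, hz⟩ hzg
    obtain ⟨x, hx, w, hw, rfl⟩ := Submodule.mem_sup.1 hz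
    obtain ⟨c, rfl⟩ := (hrd w).1 hw
    have hs := LinearPMap.sup_apply hpr ⟨_, hp.1 x hx g'⟩
      ⟨h𝒜.isGrading.proj (g' * g⁻¹) c • y, (hrd _).2 ⟨_, rfl⟩⟩ ⟨_, hz⟩
      ((hdec ⟨x, hx⟩ c g').symm.trans (Y.isGrading.proj_of_mem hzg))
    rw [hr] at hs
    refine (congrArg (· ∈ J.deg g') hs).mpr (add_mem (hp.2 g' _ (Y.isGrading.proj_mem _ _)) ?_)
    have := J.smul_mem (h𝒜.isGrading.proj_mem (g' * g⁻¹) c) hj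
    rwa [inv_mul_cancel_right] at this

/-- The graded version of Baer's criterion. -/
theorem injective_of_gradedBaer {h𝒜 : IsGradedAlgebra 𝒜} {J : GrMod 𝒜} (hJ : GradedBaer h𝒜 J) :
    Injective J where
  factors {X Y} f i _ := by
    have hi := injective_of_mono i
    let e := LinearEquiv.ofInjective i.lin hi
    let p₀ : Y →ₗ.[A] J := ⟨LinearMap.range i.lin, f.lin.comp e.symm.toLinearMap⟩
    have he : ∀ x, p₀ ⟨i.lin x, ⟨x, rfl⟩⟩ = f.lin x := fun x =>
      congrArg f.lin (e.symm_apply_apply x)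
    have hp₀ : IsGradedPMap Y J p₀ := by
      refine ⟨range_isGraded i, ?_⟩
      rintro g ⟨_, x, rfl⟩ hx
      rw [he]
      have : X.isGrading.proj g x = x := hi (by rw [hom_proj, Y.isGrading.proj_of_mem hx])
      rw [← this]
      exact f.map_deg g _ (X.isGrading.proj_mem g x)
    obtain ⟨q, hq₀, hq, hmax⟩ := zorn_le_nonempty₀ {p | IsGradedPMap Y J p} (by
      intro c hc hchain p hp
      have hdir := hchain.directedOn
      refine ⟨LinearPMap.sSup c hdir, ⟨?_, ?_⟩, fun z hz => LinearPMap.le_sSup hdir hz⟩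
      · intro y hy g
        rw [LinearPMap.mem_domain_sSup_iff ⟨p, hp⟩ hdir] at hy ⊢
        obtain ⟨r, hr, hy⟩ := hy
        exact ⟨r, hr, (hc hr).1 y hy g⟩
      · rintro g ⟨y, hy⟩ hyg
        obtain ⟨r, hr, hy'⟩ := (LinearPMap.mem_domain_sSup_iff ⟨p, hp⟩ hdir).1 hy
        have := LinearPMap.sSup_apply hdir hr ⟨y, hy'⟩
        rw [this]
        exact (hc hr).2 g ⟨y, hy'⟩ hyg) p₀ hp₀
    have htop : ∀ y, y ∈ q.domain := by
      intro y
      refine Y.isGrading.induction (p := fun y => y ∈ q.domain) (zero_mem _)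
        (fun _ _ hx hy => add_mem hx hy) ?_ y
      intro g y hy
      obtain ⟨r, hr, hqr, hyr⟩ := exists_isGradedPMap_sup hJ q hq g y hy
      exact (hmax hr hqr).1 hyr
    refine ⟨Hom.mk (q.toFun.comp (LinearMap.id.codRestrict q.domain htop))
      fun g y hy => hq.2 g ⟨y, htop y⟩ hy, hom_ext fun x => ?_⟩
    change q ⟨i.lin x, htop _⟩ = f.lin x
    rw [← he x]
    exact (hq₀.2 (x := ⟨i.lin x, ⟨x, rfl⟩⟩) (y := ⟨i.lin x, htop _⟩) rfl).symm

end Baer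

section Noetherian

variable {k A G H : Type u} [CommRing k] [Ring A] [Algebra k A] [Group G] [Group H]
  {𝒜 : G → Submodule k A} (φ : G →* H)

open GrMod

theorem fg_of_isGradedIdeal {h𝒜 : IsGradedAlgebra 𝒜} (hnoeth : IsGradedLeftNoetherian 𝒜)
    {K : Submodule A A} (hK : IsGradedIdeal h𝒜 K) : K.FG := by
  refine hnoeth (shiftAlg h𝒜 1) (inferInstanceAs (Module.Finite A A)) K fun a ha x => ?_
  exact (congrArg (· ∈ K) (proj_shiftAlg h𝒜 1 x a)).mpr (hK a ha _)

variable {φ} {h𝒜 : IsGradedAlgebra 𝒜} (M : GrMod 𝒜)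

/-- Each element of `φ^* φ_! M` has finitely many nonzero components. -/
theorem exists_finset_shiftProj (F : upperStar φ h𝒜 ((shriek φ).obj M)) :
    ∃ s : Finset G, ∀ l ∉ s, shiftProj φ h𝒜 M l F = 0 := by
  classical
  refine (upperStar φ h𝒜 ((shriek φ).obj M)).isGrading.induction
    (p := fun F => ∃ s : Finset G, ∀ l ∉ s, shiftProj φ h𝒜 M l F = 0) ⟨∅, by simp⟩ ?_ ?_ F
  · rintro F F' ⟨s, hs⟩ ⟨s', hs'⟩
    refine ⟨s ∪ s', fun l hl => ?_⟩
    rw [Finset.mem_union, not_or] at hl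
    rw [map_add, hs l hl.1, hs' l hl.2, add_zero]
  · intro g F hF
    obtain ⟨s, hs⟩ := M.isGrading.exists_sum ((shriekEquiv φ M).symm (starι φ h𝒜 _ F g))
    refine ⟨s.image fun x => g⁻¹ * x, fun l hl => ?_⟩
    rw [shiftProj_of_mem M l hF, hs, map_sum]
    refine Finset.sum_eq_zero fun x hx => M.isGrading.proj_of_mem_ne (M.isGrading.proj_mem x _) ?_
    rintro rfl
    exact hl (Finset.mem_image.2 ⟨_, hx, by rw [inv_mul_cancel_left]⟩)

theorem shiftProj_eq_zero_of_notMem (F : upperStar φ h𝒜 ((shriek φ).obj M)) {l : G}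
    (hl : l ∉ φ.ker) : shiftProj φ h𝒜 M l F = 0 := by
  refine (upperStar φ h𝒜 ((shriek φ).obj M)).isGrading.induction
    (p := fun F => shiftProj φ h𝒜 M l F = 0) (map_zero _)
    (fun x y hx hy => by rw [map_add, hx, hy, add_zero]) ?_ F
  intro g F hF
  rw [shiftProj_of_mem M l hF]
  refine proj_eq_zero_of_mem_degShriek φ M (starι_apply_mem φ h𝒜 F g) ?_
  rw [map_mul]
  simpa using hl

/-- Homogeneous elements of `φ^* φ_! M` are determined by their components. -/
theorem eq_of_shiftProj {F F' : upperStar φ h𝒜 ((shriek φ).obj M)} {g : G}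
    (hF : F ∈ (upperStar φ h𝒜 ((shriek φ).obj M)).deg g)
    (hF' : F' ∈ (upperStar φ h𝒜 ((shriek φ).obj M)).deg g)
    (h : ∀ l, shiftProj φ h𝒜 M l F = shiftProj φ h𝒜 M l F') : F = F' := by
  have hs := sub_mem hF hF'
  rw [← sub_eq_zero, eq_starMk hs]
  have h0 : starι φ h𝒜 ((shriek φ).obj M) (F - F') g = 0 := by
    refine (shriekEquiv φ M).symm.injective ?_
    rw [map_zero]
    refine M.isGrading.eq_zero_of_proj fun x => ?_
    have h1 := shiftProj_of_mem M (g⁻¹ * x) hs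
    rw [mul_inv_cancel_left] at h1
    rw [← h1, map_sub, h, sub_self]
  refine starι_injective φ h𝒜 _ ?_
  rw [starι_starMk, h0, map_zero, map_zero]

/-- Over a graded noetherian algebra the module `φ^* φ_! I`, a direct sum of shifts of `I`, is
injective if `I` is. By Baer's criterion only maps from graded left ideals matter; these are
finitely generated, so that such a map meets finitely many of the summands. -/
theorem injective_upperStar_shriek (hnoeth : IsGradedLeftNoetherian 𝒜) (I : GrMod 𝒜)
    [Injective I] : Injective (upperStar φ h𝒜 ((shriek φ).obj I)) := by
  classical
  refine injective_of_gradedBaer (h𝒜 := h𝒜) ?_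
  intro g K hK ψ hψ
  have hKfg : (⊤ : Submodule A K).FG :=
    (Submodule.fg_top K).2 (fg_of_isGradedIdeal hnoeth hK)
  obtain ⟨T, hT⟩ := hKfg
  choose s hs using fun a : K => exists_finset_shiftProj I (ψ a)
  have hzero : ∀ l ∉ T.biUnion s, ∀ a, shiftProj φ h𝒜 I l (ψ a) = 0 := by
    intro l hl a
    have : (⊤ : Submodule A K) ≤ LinearMap.ker ((shiftProj φ h𝒜 I l).comp ψ) := by
      rw [← hT, Submodule.span_le]
      exact fun b hb => hs b l fun h => hl (Finset.mem_biUnion.2 ⟨b, hb, h⟩)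
    exact this (Submodule.mem_top : a ∈ ⊤)
  have hj : ∀ l, ∃ j ∈ I.deg (g * l), ∀ a : K, shiftProj φ h𝒜 I l (ψ a) = a.1 • j := by
    intro l
    refine gradedBaer_of_injective h𝒜 I (g * l) K hK ((shiftProj φ h𝒜 I l).comp ψ) ?_
    intro g' a ha
    rw [← mul_assoc]
    exact shiftProj_mem I l (hψ g' a ha)
  choose j hj hjψ using hj
  -- The ideal is mapped to the summands indexed by `S`, where it acts on the elements `j l`; their
  -- sum, placed in degree `g`, represents the given map.
  let S := (T.biUnion s).filter fun l => l ∈ φ.ker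
  let m : I := ∑ l ∈ S, j l
  have hm : shriekEquiv φ I m ∈ ((shriek φ).obj I).deg (φ g) := by
    rw [map_sum]
    refine sum_mem fun l hl => ?_
    have h1 := shriekEquiv_mem φ I (hj l)
    have hl' : φ l = 1 := (Finset.mem_filter.1 hl).2
    rwa [map_mul, hl', mul_one] at h1
  have hmp : ∀ l, I.isGrading.proj (g * l) m = if l ∈ S then j l else 0 := by
    intro l
    have : ∀ l' ∈ S, I.isGrading.proj (g * l) (j l') = if l = l' then j l else 0 := by
      intro l' _
      by_cases h : l = l'
      · subst h
        rw [if_pos rfl, I.isGrading.proj_of_mem (hj l)]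
      · rw [if_neg h, I.isGrading.proj_of_mem_ne (hj l') (by simpa using Ne.symm h)]
    rw [map_sum, Finset.sum_congr rfl this, Finset.sum_ite_eq]
  refine ⟨starMk φ h𝒜 _ g _ hm, starMk_mem φ h𝒜 _ g _ hm, ?_⟩
  have hproj : ∀ (l : G) (a : K), shiftProj φ h𝒜 I l (ψ a) =
      shiftProj φ h𝒜 I l (a.1 • starMk φ h𝒜 _ g _ hm) := by
    intro l a
    rw [map_smul, shiftProj_of_mem I l (starMk_mem φ h𝒜 _ g _ hm), starι_starMk,
      Coind.single_same, LinearEquiv.symm_apply_apply, hmp]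
    split_ifs with h
    · exact hjψ l a
    · rw [smul_zero]
      by_cases hl : l ∈ φ.ker
      · exact hzero l (fun h' => h (Finset.mem_filter.2 ⟨h', hl⟩)) a
      · exact shiftProj_eq_zero_of_notMem I _ hl
  intro a
  obtain ⟨t, ht⟩ := h𝒜.isGrading.exists_sum a.1
  have ha : a = ∑ x ∈ t, (⟨h𝒜.isGrading.proj x a.1, hK a.1 a.2 x⟩ : K) := by
    apply Subtype.ext
    rw [AddSubmonoidClass.coe_finsetSum]
    exact ht
  have hhom : ∀ x, ψ ⟨h𝒜.isGrading.proj x a.1, hK a.1 a.2 x⟩ =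
      h𝒜.isGrading.proj x a.1 • starMk φ h𝒜 _ g _ hm := fun x =>
    eq_of_shiftProj I (hψ x _ (h𝒜.isGrading.proj_mem x _))
      (GrMod.smul_mem _ (h𝒜.isGrading.proj_mem x _) (starMk_mem φ h𝒜 _ g _ hm))
      fun l => hproj l _
  conv_lhs => rw [ha]
  rw [map_sum, Finset.sum_congr rfl fun x _ => hhom x, ← Finset.sum_smul, ← ht]

end Noetherian

end GroupGraded

/-! ### Translation by a subgroup -/

namespace GroupGraded

namespace Coind

variable {k A G : Type*} [CommRing k] [Ring A] [Algebra k A] [Group G] {𝒜 : G → Submodule k A}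
  {h𝒜 : IsGradedAlgebra 𝒜} {E : Type*} [AddCommGroup E] [Module k E] (L : Subgroup G)

instance : Module k (Coind h𝒜 E) := inferInstanceAs (Module k (G → E))

@[simp]
theorem scalar_smul_apply (c : k) (F : Coind h𝒜 E) (x : G) : (c • F) x = c • F x := rfl

variable (h𝒜 E) in
/-- Right translation of functions, as a representation of the subgroup `L`. -/
def translate : L →* Module.End k (Coind h𝒜 E) where
  toFun l :=
    { toFun := fun F x => F (x * l)
      map_add' := fun _ _ => rfl
      map_smul' := fun _ _ => rfl }
  map_one' := LinearMap.ext fun F => ext fun x => congrArg F (mul_one x)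
  map_mul' l l' := LinearMap.ext fun F => ext fun x => congrArg F (mul_assoc x l l').symm

noncomputable instance : Module (MonoidAlgebra k L) (Coind h𝒜 E) :=
  Module.compHom _ (MonoidAlgebra.lift k (Module.End k (Coind h𝒜 E)) L
    (translate h𝒜 E L)).toRingHom

variable {L}

theorem algebra_smul_def (r : MonoidAlgebra k L) (F : Coind h𝒜 E) :
    r • F = MonoidAlgebra.lift k (Module.End k (Coind h𝒜 E)) L (translate h𝒜 E L) r F := rfl

instance : IsScalarTower k (MonoidAlgebra k L) (Coind h𝒜 E) where
  smul_assoc c r F := by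
    rw [algebra_smul_def, algebra_smul_def, map_smul, LinearMap.smul_apply]

theorem single_one_smul_apply (l : L) (F : Coind h𝒜 E) (x : G) :
    ((MonoidAlgebra.single l 1 : MonoidAlgebra k L) • F) x = F (x * l) := by
  rw [algebra_smul_def, MonoidAlgebra.lift_single, one_smul]
  rfl

theorem of_smul_apply (l : L) (F : Coind h𝒜 E) (x : G) :
    (MonoidAlgebra.of k L l • F) x = F (x * l) := single_one_smul_apply l F x

variable [Module A E] [IsScalarTower k A E]

instance : SMulCommClass A (MonoidAlgebra k L) (Coind h𝒜 E) where
  smul_comm a r F := by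
    refine h𝒜.isGrading.induction (p := fun a => a • r • F = r • a • F)
      (by rw [zero_smul, zero_smul, smul_zero])
      (fun x y hx hy => by rw [add_smul, add_smul, smul_add, hx, hy]) ?_ a
    intro g a ha
    induction r using MonoidAlgebra.induction_on with
    | of l =>
      ext x
      rw [smul_apply ha, of_smul_apply, of_smul_apply, smul_apply ha, mul_assoc]
    | add r r' hr hr' => rw [add_smul, add_smul, smul_add, hr, hr']
    | smul c r hr =>
      rw [smul_assoc, smul_assoc, ← hr]
      ext x
      rw [smul_apply ha, scalar_smul_apply, scalar_smul_apply, smul_apply ha, smul_comm]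

instance : SMulCommClass (MonoidAlgebra k L) A (Coind h𝒜 E) := .symm _ _ _

end Coind

/-! ### Coinduction with coefficients in a module over the group algebra of the kernel -/

namespace GrMod

variable {k A G H : Type u} [CommRing k] [Ring A] [Algebra k A] [Group G] [Group H]
  {𝒜 : G → Submodule k A} (φ : G →* H) (h𝒜 : IsGradedAlgebra 𝒜) (N : GrMod (algShriek φ 𝒜))

/-- The functions supported on the fibre of `φ` at `h`, with values in `N_h`. -/
def fibre (h : H) : Submodule (MonoidAlgebra k φ.ker) (Coind h𝒜 N) where
  carrier := {F | ∀ g, F g ∈ N.deg h ∧ (φ g ≠ h → F g = 0)}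
  zero_mem' := fun g => ⟨(N.deg h).zero_mem, fun _ => rfl⟩
  add_mem' := fun {F F'} hF hF' g => ⟨(N.deg h).add_mem (hF g).1 (hF' g).1, fun hg => by
    rw [Coind.add_apply, (hF g).2 hg, (hF' g).2 hg, add_zero]⟩
  smul_mem' := by
    intro r F hF
    induction r using MonoidAlgebra.induction_on with
    | of l =>
      intro g
      rw [Coind.of_smul_apply]
      refine ⟨(hF _).1, fun hg => (hF _).2 ?_⟩
      rwa [map_mul, l.2, mul_one]
    | add r r' hr hr' =>
      intro g
      rw [add_smul]
      exact ⟨(N.deg h).add_mem (hr g).1 (hr' g).1, fun hg => by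
        rw [Coind.add_apply, (hr g).2 hg, (hr' g).2 hg, add_zero]⟩
    | smul c r hr =>
      intro g
      rw [smul_assoc, Coind.scalar_smul_apply]
      exact ⟨scalar_smul_mem (h𝒜.shriek φ) N c (hr g).1, fun hg => by rw [(hr g).2 hg, smul_zero]⟩

variable {φ h𝒜 N} in
theorem smul_mem_fibre {h h' : H} {a : A} {F : Coind h𝒜 N} (ha : a ∈ algShriek φ 𝒜 h)
    (hF : F ∈ fibre φ h𝒜 N h') : a • F ∈ fibre φ h𝒜 N (h * h') := by
  refine AddSubmonoid.closure_induction (motive := fun y _ => y • F ∈ fibre φ h𝒜 N (h * h')) ?_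
    (by rw [zero_smul]; exact zero_mem _)
    (fun y z _ _ hy hz => by rw [add_smul]; exact add_mem hy hz) (algShriek_mem_closure φ 𝒜 ha)
  rintro y ⟨g, rfl, hy⟩ x
  rw [Coind.smul_apply hy]
  refine ⟨N.smul_mem (mem_algShriek φ 𝒜 hy) (hF _).1, fun hx => ?_⟩
  rw [(hF _).2, smul_zero]
  intro h1
  apply hx
  rw [← h1, map_mul, map_inv, mul_inv_cancel_left]

open scoped Classical in
/-- Restriction of a function to the fibre of `φ` at `h`. -/
noncomputable def fibreProj (h : H) : Coind h𝒜 N →ₗ[MonoidAlgebra k φ.ker] Coind h𝒜 N :=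
  MonoidAlgebra.equivariantOfLinearOfComm
    { toFun := fun F g => if φ g = h then F g else 0
      map_add' := fun F F' => Coind.ext fun g => by
        change (if φ g = h then F g + F' g else 0) =
          (if φ g = h then F g else 0) + (if φ g = h then F' g else 0)
        split_ifs <;> simp
      map_smul' := fun c F => Coind.ext fun g => by
        change (if φ g = h then c • F g else 0) = c • (if φ g = h then F g else 0)
        split_ifs <;> simp }
    fun l F => Coind.ext fun g => by
      rw [Coind.single_one_smul_apply]
      change (if φ g = h then _ else 0) = if φ (g * l) = h then F (g * l) else 0
      rw [Coind.single_one_smul_apply, map_mul, l.2, mul_one]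

open scoped Classical in
variable {φ h𝒜 N} in
theorem fibreProj_apply (h : H) (F : Coind h𝒜 N) (g : G) :
    fibreProj φ h𝒜 N h F g = if φ g = h then F g else 0 := rfl

section CoindHom

variable (V : Type u) [AddCommGroup V] [Module (MonoidAlgebra k φ.ker) V]

/-- The maps from `V` to the fibre at `h`. -/
def fibreHom (h : H) : AddSubgroup (V →ₗ[MonoidAlgebra k φ.ker] Coind h𝒜 N) where
  carrier := {u | ∀ v, u v ∈ fibre φ h𝒜 N h}
  zero_mem' := fun _ => zero_mem _
  add_mem' := fun hu hu' v => add_mem (hu v) (hu' v)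
  neg_mem' := fun hu v => neg_mem (hu v)

/-- For a `k[ker φ]`-module `V`, the `H`-graded module whose component of degree `h` consists of
the `k[ker φ]`-linear maps from `V` to the functions `φ⁻¹(h) → N_h`. -/
noncomputable def coindHom : GrMod (algShriek φ 𝒜) :=
  ofFamily (h𝒜.shriek φ) (fibreHom φ h𝒜 N V)
    (fun h => { toFun := fun u => (fibreProj φ h𝒜 N h).comp u
                map_zero' := LinearMap.comp_zero _
                map_add' := fun u u' => LinearMap.comp_add u u' _ })
    (fun h u hu => LinearMap.ext fun v => Coind.ext fun g => by
      classical
      change fibreProj φ h𝒜 N h (u v) g = u v g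
      rw [fibreProj_apply]
      split_ifs with hg
      · rfl
      · exact ((hu v g).2 hg).symm)
    (fun h h' hh u hu => LinearMap.ext fun v => Coind.ext fun g => by
      classical
      change fibreProj φ h𝒜 N h' (u v) g = 0
      rw [fibreProj_apply]
      split_ifs with hg
      · exact (hu v g).2 (by rw [hg]; exact hh.symm)
      · rfl)
    (fun _ _ a u ha hu v => smul_mem_fibre (F := u v) ha (hu v))

/-- The linear map underlying an element of `coindHom`. -/
noncomputable def coindHomι :
    coindHom φ h𝒜 N V →ₗ[A] (V →ₗ[MonoidAlgebra k φ.ker] Coind h𝒜 N) := famι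

theorem coindHomι_injective : Function.Injective (coindHomι φ h𝒜 N V) := Subtype.val_injective

variable {φ h𝒜 N V}

theorem mem_deg_coindHom {h : H} {u : coindHom φ h𝒜 N V} :
    u ∈ (coindHom φ h𝒜 N V).deg h ↔ ∀ v, coindHomι φ h𝒜 N V u v ∈ fibre φ h𝒜 N h := Iff.rfl

variable (φ h𝒜 N) in
/-- A linear map from `V` to a fibre, as an element of `coindHom`. -/
noncomputable def coindHomMk (h : H) (u : V →ₗ[MonoidAlgebra k φ.ker] Coind h𝒜 N)
    (hu : ∀ v, u v ∈ fibre φ h𝒜 N h) : coindHom φ h𝒜 N V := famMk h u hu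

/-- A morphism to `coindHom`. -/
noncomputable def toCoindHom {X : GrMod (algShriek φ 𝒜)}
    (u : X →ₗ[A] (V →ₗ[MonoidAlgebra k φ.ker] Coind h𝒜 N))
    (hu : ∀ h, ∀ x ∈ X.deg h, ∀ v, u x v ∈ fibre φ h𝒜 N h) : X ⟶ coindHom φ h𝒜 N V :=
  toFamily u hu

variable {V' : Type u} [AddCommGroup V'] [Module (MonoidAlgebra k φ.ker) V']

variable (φ h𝒜 N) in
/-- The functoriality of `coindHom`: composition with a linear map `V → V'`. -/
noncomputable def coindHomMap (f : V →ₗ[MonoidAlgebra k φ.ker] V') :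
    coindHom φ h𝒜 N V' ⟶ coindHom φ h𝒜 N V :=
  toCoindHom
    { toFun := fun u => (coindHomι φ h𝒜 N V' u).comp f
      map_add' := fun u u' => by rw [map_add, LinearMap.add_comp]
      map_smul' := fun a u => by rw [map_smul, LinearMap.smul_comp, RingHom.id_apply] }
    fun _ _ hu v => mem_deg_coindHom.1 hu (f v)

theorem coindHomι_map (f : V →ₗ[MonoidAlgebra k φ.ker] V') (u : coindHom φ h𝒜 N V') :
    coindHomι φ h𝒜 N V ((coindHomMap φ h𝒜 N f).lin u) = (coindHomι φ h𝒜 N V' u).comp f := rfl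

theorem coindHomMap_comp_eq_zero {V'' : Type u} [AddCommGroup V'']
    [Module (MonoidAlgebra k φ.ker) V''] (f : V →ₗ[MonoidAlgebra k φ.ker] V')
    (f' : V' →ₗ[MonoidAlgebra k φ.ker] V'') (h : f'.comp f = 0) :
    coindHomMap φ h𝒜 N f' ≫ coindHomMap φ h𝒜 N f = 0 :=
  hom_ext fun u => coindHomι_injective φ h𝒜 N V <| by
    rw [comp_lin, LinearMap.comp_apply, coindHomι_map, coindHomι_map, LinearMap.comp_assoc, h,
      LinearMap.comp_zero]
    exact (map_zero (coindHomι φ h𝒜 N V)).symm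

end CoindHom

end GrMod

end GroupGraded

/-! ### Injectivity of coinduced modules with projective coefficients -/

namespace GroupGraded

namespace GrMod

variable {k A G H : Type u} [CommRing k] [Ring A] [Algebra k A] [Group G] [Group H]
  {𝒜 : G → Submodule k A} (φ : G →* H) (h𝒜 : IsGradedAlgebra 𝒜) (N : GrMod (algShriek φ 𝒜))

/-- The linear maps from `X` to functions on `G` which send `X_h` to the fibre at `h`. They are
the morphisms `φ^* X ⟶ φ^* N`, and carry an action of `k[ker φ]`. -/
def fibreMaps (X : GrMod (algShriek φ 𝒜)) :
    Submodule (MonoidAlgebra k φ.ker) (X →ₗ[A] Coind h𝒜 N) where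
  carrier := {u | ∀ h, ∀ x ∈ X.deg h, u x ∈ fibre φ h𝒜 N h}
  zero_mem' := fun _ _ _ => zero_mem _
  add_mem' := fun hu hu' h x hx => add_mem (hu h x hx) (hu' h x hx)
  smul_mem' := fun r _ hu h x hx => Submodule.smul_mem _ r (hu h x hx)

variable {φ h𝒜 N}

/-- The morphism `φ^* X ⟶ φ^* N` attached to a map from `X` to functions on `G`. -/
noncomputable def starOfFibreMap {X : GrMod (algShriek φ 𝒜)} (u : X →ₗ[A] Coind h𝒜 N)
    (hu : u ∈ fibreMaps φ h𝒜 N X) : upperStar φ h𝒜 X ⟶ upperStar φ h𝒜 N :=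
  intoPull (hB := smul_mem_of_deg φ N)
    (linOfHomog h𝒜
      { toFun := fun F g => u (starι φ h𝒜 X F g) g
        map_zero' := Coind.ext fun g => by
          change u (starι φ h𝒜 X 0 g) g = 0
          rw [map_zero, Coind.zero_apply, map_zero, Coind.zero_apply]
        map_add' := fun F F' => Coind.ext fun g => by
          change u (starι φ h𝒜 X (F + F') g) g =
            u (starι φ h𝒜 X F g) g + u (starι φ h𝒜 X F' g) g
          rw [map_add, Coind.add_apply, map_add, Coind.add_apply] }
      fun g a ha F => Coind.ext fun x => by
        rw [Coind.smul_apply ha]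
        change u (starι φ h𝒜 X (a • F) x) x = a • u (starι φ h𝒜 X F (g⁻¹ * x)) (g⁻¹ * x)
        rw [map_smul, Coind.smul_apply ha, map_smul, Coind.smul_apply ha])
    fun g F hF => by
      refine ⟨(hu (φ g) _ (mem_deg_upperStar.1 hF).1 g).1, fun x hx => ?_⟩
      change u (starι φ h𝒜 X F x) x = 0
      rw [(mem_deg_upperStar.1 hF).2 x hx, map_zero, Coind.zero_apply]

theorem starι_starOfFibreMap {X : GrMod (algShriek φ 𝒜)} (u : X →ₗ[A] Coind h𝒜 N)
    (hu : u ∈ fibreMaps φ h𝒜 N X) (F : upperStar φ h𝒜 X) (g : G) :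
    starι φ h𝒜 N ((starOfFibreMap u hu).lin F) g = u (starι φ h𝒜 X F g) g := rfl

variable (φ h𝒜) in
/-- The part of degree `φ g` of an element, placed in degree `g`. -/
noncomputable def starComp (Y : GrMod (algShriek φ 𝒜)) (g : G) : Y →+ upperStar φ h𝒜 Y where
  toFun y := starMk φ h𝒜 Y g (Y.isGrading.proj (φ g) y) (Y.isGrading.proj_mem _ _)
  map_zero' := starι_injective φ h𝒜 Y (by
    rw [starι_starMk, map_zero, map_zero, map_zero])
  map_add' y z := starι_injective φ h𝒜 Y (by
    rw [map_add (starι φ h𝒜 Y), starι_starMk, starι_starMk, starι_starMk, map_add, map_add])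

theorem starι_starComp (Y : GrMod (algShriek φ 𝒜)) (g : G) (y : Y) :
    starι φ h𝒜 Y (starComp φ h𝒜 Y g y) = Coind.single g (Y.isGrading.proj (φ g) y) := rfl

theorem starComp_smul (Y : GrMod (algShriek φ 𝒜)) {g : G} {a : A} (ha : a ∈ 𝒜 g) (x : G) (y : Y) :
    starComp φ h𝒜 Y x (a • y) = a • starComp φ h𝒜 Y (g⁻¹ * x) y := by
  refine starι_injective φ h𝒜 Y ?_
  rw [map_smul (starι φ h𝒜 Y), starι_starComp, starι_starComp, Coind.smul_single ha,
    mul_inv_cancel_left, proj_smul Y (mem_algShriek φ 𝒜 ha), map_mul, map_inv]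

theorem upperStarMap_starComp {X Y : GrMod (algShriek φ 𝒜)} (i : X ⟶ Y) (g : G) (x : X) :
    (upperStarMap φ h𝒜 i).lin (starComp φ h𝒜 X g x) = starComp φ h𝒜 Y g (i.lin x) := by
  refine (upperStarMap_starMk i g _ (X.isGrading.proj_mem _ _)).trans (starι_injective φ h𝒜 Y ?_)
  rw [starι_starComp, starι_starMk, hom_proj]

/-- The map from `Y` to functions on `G` attached to a morphism `φ^* Y ⟶ φ^* N`. -/
noncomputable def fibreMapOfStar {Y : GrMod (algShriek φ 𝒜)}
    (θ : upperStar φ h𝒜 Y ⟶ upperStar φ h𝒜 N) : Y →ₗ[A] Coind h𝒜 N :=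
  linOfHomog h𝒜
    { toFun := fun y g => starι φ h𝒜 N (θ.lin (starComp φ h𝒜 Y g y)) g
      map_zero' := Coind.ext fun g => by
        change starι φ h𝒜 N (θ.lin (starComp φ h𝒜 Y g 0)) g = 0
        rw [map_zero, map_zero, map_zero, Coind.zero_apply]
      map_add' := fun y z => Coind.ext fun g => by
        change starι φ h𝒜 N (θ.lin (starComp φ h𝒜 Y g (y + z))) g =
          starι φ h𝒜 N (θ.lin (starComp φ h𝒜 Y g y)) g +
            starι φ h𝒜 N (θ.lin (starComp φ h𝒜 Y g z)) g
        rw [map_add, map_add, map_add, Coind.add_apply] }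
    fun g a ha y => Coind.ext fun x => by
      rw [Coind.smul_apply ha]
      change starι φ h𝒜 N (θ.lin (starComp φ h𝒜 Y x (a • y))) x =
        a • starι φ h𝒜 N (θ.lin (starComp φ h𝒜 Y (g⁻¹ * x) y)) (g⁻¹ * x)
      rw [starComp_smul Y ha, map_smul, map_smul, Coind.smul_apply ha]

theorem fibreMapOfStar_apply {Y : GrMod (algShriek φ 𝒜)}
    (θ : upperStar φ h𝒜 Y ⟶ upperStar φ h𝒜 N) (y : Y) (g : G) :
    fibreMapOfStar θ y g = starι φ h𝒜 N (θ.lin (starComp φ h𝒜 Y g y)) g := rfl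

theorem fibreMapOfStar_mem {Y : GrMod (algShriek φ 𝒜)}
    (θ : upperStar φ h𝒜 Y ⟶ upperStar φ h𝒜 N) : fibreMapOfStar θ ∈ fibreMaps φ h𝒜 N Y := by
  intro h y hy g
  rw [fibreMapOfStar_apply]
  have h0 : φ g ≠ h → starι φ h𝒜 N (θ.lin (starComp φ h𝒜 Y g y)) g = 0 := by
    intro hg
    have : starComp φ h𝒜 Y g y = 0 := starι_injective φ h𝒜 Y (by
      rw [starι_starComp, Y.isGrading.proj_of_mem_ne hy (Ne.symm hg), map_zero, map_zero])
    rw [this, map_zero, map_zero, Coind.zero_apply]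
  refine ⟨?_, h0⟩
  by_cases hg : φ g = h
  · rw [← hg]
    exact starι_apply_mem φ h𝒜 _ g
  · rw [h0 hg]
    exact zero_mem _

variable (φ h𝒜 N) in
/-- Restriction of maps along a morphism. -/
noncomputable def fibreMapsRestrict {X Y : GrMod (algShriek φ 𝒜)} (i : X ⟶ Y) :
    fibreMaps φ h𝒜 N Y →ₗ[MonoidAlgebra k φ.ker] fibreMaps φ h𝒜 N X where
  toFun u := ⟨u.1.comp i.lin, fun h x hx => u.2 h _ (i.map_deg h x hx)⟩
  map_add' _ _ := rfl
  map_smul' _ _ := rfl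

theorem fibreMapsRestrict_surjective [Injective (upperStar φ h𝒜 N)]
    {X Y : GrMod (algShriek φ 𝒜)} (i : X ⟶ Y) [Mono i] :
    Function.Surjective (fibreMapsRestrict φ h𝒜 N i) := by
  rintro ⟨u, hu⟩
  have : Mono (upperStarMap φ h𝒜 i) :=
    mono_of_injective _ (injective_upperStarMap i (injective_of_mono i))
  let θ := Injective.factorThru (starOfFibreMap u hu) (upperStarMap φ h𝒜 i)
  have hθ : upperStarMap φ h𝒜 i ≫ θ = starOfFibreMap u hu := Injective.comp_factorThru _ _
  refine ⟨⟨fibreMapOfStar θ, fibreMapOfStar_mem θ⟩, Subtype.ext (LinearMap.ext fun x =>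
    Coind.ext fun g => ?_)⟩
  change fibreMapOfStar θ (i.lin x) g = u x g
  have h1 : θ.lin ((upperStarMap φ h𝒜 i).lin (starComp φ h𝒜 X g x)) =
      (starOfFibreMap u hu).lin (starComp φ h𝒜 X g x) :=
    congrArg (fun t : upperStar φ h𝒜 X ⟶ upperStar φ h𝒜 N => t.lin (starComp φ h𝒜 X g x)) hθ
  rw [fibreMapOfStar_apply, ← upperStarMap_starComp, h1, starι_starOfFibreMap, starι_starComp,
    Coind.single_same]
  refine X.isGrading.induction (p := fun x => u (X.isGrading.proj (φ g) x) g = u x g)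
    (by rw [map_zero])
    (fun y z hy hz => by simp only [map_add, Coind.add_apply, hy, hz]) ?_ x
  intro h x hx
  by_cases hg : h = φ g
  · subst hg
    rw [X.isGrading.proj_of_mem hx]
  · rw [X.isGrading.proj_of_mem_ne hx hg, map_zero, Coind.zero_apply, (hu h x hx g).2 (Ne.symm hg)]

/-- `coindHom φ h𝒜 N P` is injective if `P` is projective and `φ^* N` is injective: morphisms
`X ⟶ coindHom φ h𝒜 N P` are linear maps from `P` to `fibreMaps φ h𝒜 N X`, which is exact
in `X`. -/
theorem injective_coindHom [Injective (upperStar φ h𝒜 N)] (P : Type u) [AddCommGroup P]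
    [Module (MonoidAlgebra k φ.ker) P] [Module.Projective (MonoidAlgebra k φ.ker) P] :
    Injective (coindHom φ h𝒜 N P) where
  factors {X Y} f i _ := by
    let c : P →ₗ[MonoidAlgebra k φ.ker] fibreMaps φ h𝒜 N X :=
      { toFun := fun v =>
          ⟨{ toFun := fun x => coindHomι φ h𝒜 N P (f.lin x) v
             map_add' := fun x y => by rw [map_add, map_add, LinearMap.add_apply]
             map_smul' := fun a x => by
               rw [map_smul, map_smul, LinearMap.smul_apply, RingHom.id_apply] },
            fun h x hx => mem_deg_coindHom.1 (f.map_deg h x hx) v⟩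
        map_add' := fun v w => Subtype.ext (LinearMap.ext fun x =>
          (coindHomι φ h𝒜 N P (f.lin x)).map_add v w)
        map_smul' := fun r v => Subtype.ext (LinearMap.ext fun x =>
          (coindHomι φ h𝒜 N P (f.lin x)).map_smul r v) }
    obtain ⟨c', hc'⟩ := Module.projective_lifting_property (fibreMapsRestrict φ h𝒜 N i) c
      (fibreMapsRestrict_surjective i)
    refine ⟨toCoindHom
      { toFun := fun y =>
          { toFun := fun v => (c' v).1 y
            map_add' := fun v w => by rw [map_add]; rfl
            map_smul' := fun r v => by rw [map_smul]; rfl }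
        map_add' := fun y z => LinearMap.ext fun v => map_add (c' v).1 y z
        map_smul' := fun a y => LinearMap.ext fun v => (c' v).1.map_smul a y }
      fun h y hy v => (c' v).2 h y hy, hom_ext fun x => coindHomι_injective φ h𝒜 N P ?_⟩
    refine LinearMap.ext fun v => ?_
    exact congrArg (fun t : P →ₗ[MonoidAlgebra k φ.ker] fibreMaps φ h𝒜 N X => (t v).1 x) hc'

/-! ### Exactness in the coefficients -/

section Exact

variable {K P V : Type u} [AddCommGroup K] [AddCommGroup P] [AddCommGroup V]
  [Module (MonoidAlgebra k φ.ker) K] [Module (MonoidAlgebra k φ.ker) P]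
  [Module (MonoidAlgebra k φ.ker) V] [Module k K] [Module k P]
  [IsScalarTower k (MonoidAlgebra k φ.ker) P] [IsScalarTower k (MonoidAlgebra k φ.ker) K]

/-- Maps to a fibre extend along an injection which splits over `k`, since the functions on a fibre
are coinduced from the trivial group. -/
theorem exists_extension_fibreHom (ι : K →ₗ[MonoidAlgebra k φ.ker] P) (r : P →ₗ[k] K)
    (hr : ∀ x, r (ι x) = x) {h : H} (u : K →ₗ[MonoidAlgebra k φ.ker] Coind h𝒜 N)
    (hu : ∀ v, u v ∈ fibre φ h𝒜 N h) :
    ∃ u' : P →ₗ[MonoidAlgebra k φ.ker] Coind h𝒜 N, (∀ v, u' v ∈ fibre φ h𝒜 N h) ∧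
      u'.comp ι = u := by
  classical
  by_cases hh : ∃ g₀, φ g₀ = h
  · obtain ⟨g₀, rfl⟩ := hh
    -- An element of the fibre is determined by its translates at the base point `g₀`.
    let t : G → φ.ker := fun g =>
      if hg : φ g = φ g₀ then ⟨g₀⁻¹ * g, by simp [MonoidHom.mem_ker, hg]⟩ else 1
    have ht : ∀ g, φ g = φ g₀ → (t g : G) = g₀⁻¹ * g := fun g hg => by simp only [t, dif_pos hg]
    let s : φ.ker → MonoidAlgebra k φ.ker := fun l => MonoidAlgebra.single l 1
    let f : P →ₗ[k] Coind h𝒜 N :=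
      { toFun := fun p g => if φ g = φ g₀ then u (r (s (t g) • p)) g₀ else 0
        map_add' := fun p q => Coind.ext fun g => by
          change (if φ g = φ g₀ then u (r (s (t g) • (p + q))) g₀ else 0) =
            (if φ g = φ g₀ then u (r (s (t g) • p)) g₀ else 0) +
              (if φ g = φ g₀ then u (r (s (t g) • q)) g₀ else 0)
          split_ifs
          · rw [smul_add, map_add, map_add, Coind.add_apply]
          · rw [add_zero]
        map_smul' := fun c p => Coind.ext fun g => by
          change (if φ g = φ g₀ then u (r (s (t g) • c • p)) g₀ else 0) =
            c • (if φ g = φ g₀ then u (r (s (t g) • p)) g₀ else 0)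
          split_ifs
          · rw [smul_comm, map_smul, ← algebraMap_smul (MonoidAlgebra k φ.ker) c, map_smul,
              algebraMap_smul, Coind.scalar_smul_apply]
          · rw [smul_zero] }
    have hf : ∀ p g, f p g = if φ g = φ g₀ then u (r (s (t g) • p)) g₀ else 0 := fun _ _ => rfl
    have hcomm : ∀ (l : φ.ker) (p : P), f (s l • p) = s l • f p := by
      intro l p
      ext g
      rw [Coind.single_one_smul_apply, hf, hf, map_mul, l.2, mul_one]
      split_ifs with hg
      · have h1 : t (g * l) = t g * l := by
          apply Subtype.ext
          rw [ht _ (by rw [map_mul, l.2, mul_one, hg]), Subgroup.coe_mul, ht g hg, mul_assoc]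
        rw [← mul_smul, MonoidAlgebra.single_mul_single, mul_one, h1]
      · rfl
    refine ⟨MonoidAlgebra.equivariantOfLinearOfComm f hcomm, fun p g => ?_,
      LinearMap.ext fun v => Coind.ext fun g => ?_⟩
    · change f p g ∈ _ ∧ (_ → f p g = 0)
      rw [hf]
      refine ⟨?_, fun hg => if_neg hg⟩
      split_ifs
      · exact (hu _ _).1
      · exact zero_mem _
    · change f (ι v) g = u v g
      rw [hf]
      split_ifs with hg
      · rw [← map_smul, hr, map_smul, Coind.single_one_smul_apply, ht g hg, mul_inv_cancel_left]
      · exact ((hu v g).2 hg).symm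
  · push Not at hh
    refine ⟨0, fun _ => zero_mem _, LinearMap.ext fun v => Coind.ext fun g => ?_⟩
    exact ((hu v g).2 (hh g)).symm

variable (h𝒜 N) in
/-- `coindHom` turns an exact sequence of coefficients which splits over `k` into an exact
sequence. -/
theorem coindHom_shortExact (ι : K →ₗ[MonoidAlgebra k φ.ker] P)
    (π : P →ₗ[MonoidAlgebra k φ.ker] V) (hπι : π.comp ι = 0)
    (hex : ∀ p, π p = 0 → ∃ x, ι x = p) (hπ : Function.Surjective π) (r : P →ₗ[k] K)
    (hr : ∀ x, r (ι x) = x) :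
    (ShortComplex.mk (coindHomMap φ h𝒜 N π) (coindHomMap φ h𝒜 N ι)
      (coindHomMap_comp_eq_zero ι π hπι)).ShortExact := by
  refine shortExact_of_homogeneous _ ?_ ?_ ?_
  · intro h u _ hu0
    refine coindHomι_injective φ h𝒜 N V (LinearMap.ext fun v => ?_)
    obtain ⟨p, rfl⟩ := hπ v
    have h1 := congrArg (fun w => coindHomι φ h𝒜 N P w p) hu0
    refine h1.trans ?_
    simp only [map_zero, LinearMap.zero_apply]
  · intro h u hu hu0
    have hu0' : ∀ x, coindHomι φ h𝒜 N P u (ι x) = 0 := fun x => by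
      have h1 := congrArg (fun w => coindHomι φ h𝒜 N K w x) hu0
      refine h1.trans ?_
      simp only [map_zero, LinearMap.zero_apply]
    have hker : LinearMap.ker π ≤ LinearMap.ker (coindHomι φ h𝒜 N P u) := by
      intro p hp
      obtain ⟨x, rfl⟩ := hex p hp
      exact hu0' x
    let w : V →ₗ[MonoidAlgebra k φ.ker] Coind h𝒜 N :=
      ((LinearMap.ker π).liftQ (coindHomι φ h𝒜 N P u) hker).comp
        (π.quotKerEquivOfSurjective hπ).symm.toLinearMap
    have hw : ∀ p, w (π p) = coindHomι φ h𝒜 N P u p := fun p => by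
      have h1 : (π.quotKerEquivOfSurjective hπ).symm (π p) = Submodule.Quotient.mk p := by
        rw [LinearEquiv.symm_apply_eq]
        rfl
      exact (congrArg ((LinearMap.ker π).liftQ (coindHomι φ h𝒜 N P u) hker) h1).trans rfl
    refine ⟨coindHomMk φ h𝒜 N h w fun v => ?_,
      coindHomι_injective φ h𝒜 N P (LinearMap.ext hw)⟩
    obtain ⟨p, rfl⟩ := hπ v
    rw [hw]
    exact mem_deg_coindHom.1 hu p
  · intro h u hu
    obtain ⟨u', hu', hu''⟩ := exists_extension_fibreHom ι r hr _ (mem_deg_coindHom.1 hu)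
    exact ⟨coindHomMk φ h𝒜 N h u' hu', coindHomι_injective φ h𝒜 N K hu''⟩

end Exact

/-! ### Dimension shifting in the coefficients -/

/-- The step of the dimension shift: `V` is the quotient of a projective module `P` by `ker π`,
and the sequence splits over `k` because `V` is projective over `k`. -/
theorem hasInjectiveDimensionLT_coindHom_of_ker [Injective (upperStar φ h𝒜 N)] (n : ℕ)
    {P V : Type u} [AddCommGroup P] [AddCommGroup V] [Module k P] [Module k V]
    [Module (MonoidAlgebra k φ.ker) P] [Module (MonoidAlgebra k φ.ker) V]
    [IsScalarTower k (MonoidAlgebra k φ.ker) P] [IsScalarTower k (MonoidAlgebra k φ.ker) V]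
    [Module.Projective k P] [Module.Projective k V]
    [Module.Projective (MonoidAlgebra k φ.ker) P] (π : P →ₗ[MonoidAlgebra k φ.ker] V)
    (hπ : Function.Surjective π)
    (hK : Module.Projective k (LinearMap.ker π) →
      HasInjectiveDimensionLT (coindHom φ h𝒜 N (LinearMap.ker π)) (n + 1)) :
    HasInjectiveDimensionLT (coindHom φ h𝒜 N V) (n + 2) := by
  obtain ⟨s, hs⟩ := Module.projective_lifting_property (π.restrictScalars k)
    (LinearMap.id : V →ₗ[k] V) hπ
  have hs' : ∀ v, π (s v) = v := fun v => congrArg (fun t : V →ₗ[k] V => t v) hs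
  let r : P →ₗ[k] LinearMap.ker π :=
    { toFun := fun p => ⟨p - s (π p), by rw [LinearMap.mem_ker, map_sub, hs', sub_self]⟩
      map_add' := fun p q => Subtype.ext (by
        change p + q - s (π (p + q)) = p - s (π p) + (q - s (π q))
        rw [map_add, map_add]
        abel)
      map_smul' := fun c p => Subtype.ext (by
        change c • p - s (π (c • p)) = c • (p - s (π p))
        rw [← LinearMap.restrictScalars_apply k π (c • p), map_smul, map_smul, smul_sub]
        rfl) }
  have hr : ∀ x : LinearMap.ker π, r ((LinearMap.ker π).subtype x) = x := fun x => Subtype.ext (by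
    change x.1 - s (π x.1) = x.1
    rw [LinearMap.mem_ker.1 x.2, map_zero, sub_zero])
  have : Module.Projective k (LinearMap.ker π) :=
    Module.Projective.of_split ((LinearMap.ker π).subtype.restrictScalars k) r (LinearMap.ext hr)
  have hT := coindHom_shortExact h𝒜 N (LinearMap.ker π).subtype π
    (LinearMap.ext fun x => x.2) (fun p hp => ⟨⟨p, hp⟩, rfl⟩) hπ r hr
  exact (hT.hasInjectiveDimensionLT_X₃_iff n (injective_coindHom P)).1 (hK this)

/-- For `V` projective over `k`, the injective dimension of `coindHom φ h𝒜 N V` is at most the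
projective dimension of `V`. -/
theorem hasInjectiveDimensionLT_coindHom [Injective (upperStar φ h𝒜 N)] (n : ℕ) (V : Type u)
    [AddCommGroup V] [Module k V] [Module (MonoidAlgebra k φ.ker) V]
    [IsScalarTower k (MonoidAlgebra k φ.ker) V] [Module.Projective k V]
    [HasProjectiveDimensionLT (ModuleCat.of (MonoidAlgebra k φ.ker) V) (n + 1)] :
    HasInjectiveDimensionLT (coindHom φ h𝒜 N V) (n + 1) := by
  induction n generalizing V with
  | zero =>
    have : Projective (ModuleCat.of (MonoidAlgebra k φ.ker) V) :=
      projective_iff_hasProjectiveDimensionLT_one.2 ‹_›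
    have : Module.Projective (MonoidAlgebra k φ.ker) V := (IsProjective.iff_projective V).2 this
    rw [zero_add, ← injective_iff_hasInjectiveDimensionLT_one]
    exact injective_coindHom V
  | succ n ih =>
    have hπ := Finsupp.linearCombination_id_surjective (MonoidAlgebra k φ.ker) V
    refine hasInjectiveDimensionLT_coindHom_of_ker n _ hπ fun _ => ?_
    have hP : Projective (ModuleCat.of (MonoidAlgebra k φ.ker) (V →₀ MonoidAlgebra k φ.ker)) :=
      (IsProjective.iff_projective _).1 inferInstance
    have := ((LinearMap.shortExact_shortComplexKer hπ).hasProjectiveDimensionLT_X₃_iff n hP).1 ‹_›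
    exact ih _

/-! ### Trivial coefficients -/

section Trivial

variable {V : Type u} [AddCommGroup V] [Module k V] [Module (MonoidAlgebra k φ.ker) V]
    [IsScalarTower k (MonoidAlgebra k φ.ker) V] (e : V ≃ₗ[k] k)
    (he : ∀ (l : φ.ker) (v : V), (MonoidAlgebra.single l 1 : MonoidAlgebra k φ.ker) • v = v)

variable (φ h𝒜) in
/-- For `n` in `N`, the map sending `v` to `e v` times the function whose value at `g` is the
component of `n` of degree `φ g`. -/
noncomputable def constMap (n : N) : V →ₗ[MonoidAlgebra k φ.ker] Coind h𝒜 N :=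
  let f : V →ₗ[k] Coind h𝒜 N :=
    { toFun := fun v g => e v • N.isGrading.proj (φ g) n
      map_add' := fun v w => Coind.ext fun g =>
        (congrArg (· • N.isGrading.proj (φ g) n) (map_add e v w)).trans (add_smul _ _ _)
      map_smul' := fun c v => Coind.ext fun g =>
        (congrArg (· • N.isGrading.proj (φ g) n) (map_smul e c v)).trans (mul_smul _ _ _) }
  MonoidAlgebra.equivariantOfLinearOfComm f fun l v => Coind.ext fun g => by
    rw [Coind.single_one_smul_apply, he]
    change e v • N.isGrading.proj (φ g) n = e v • N.isGrading.proj (φ (g * l)) n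
    rw [map_mul, l.2, mul_one]

theorem constMap_apply (n : N) (v : V) (g : G) :
    constMap φ h𝒜 e he n v g = e v • N.isGrading.proj (φ g) n := rfl

theorem constMap_mem {h : H} {n : N} (hn : n ∈ N.deg h) (v : V) :
    constMap φ h𝒜 e he n v ∈ fibre φ h𝒜 N h := fun g => by
  rw [constMap_apply]
  refine ⟨scalar_smul_mem (h𝒜.shriek φ) N _ ?_, fun hg => ?_⟩
  · by_cases hg : h = φ g
    · subst hg
      exact N.isGrading.proj_mem _ _
    · rw [N.isGrading.proj_of_mem_ne hn hg]
      exact zero_mem _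
  · rw [N.isGrading.proj_of_mem_ne hn (Ne.symm hg), smul_zero]

variable (h𝒜 N) in
/-- The morphism from `N` to `coindHom` with trivial coefficients which sends an element of
degree `h` to a constant function on the fibre at `h`. -/
noncomputable def constHom : N ⟶ coindHom φ h𝒜 N V :=
  toCoindHom
    (linOfHomog h𝒜
      { toFun := constMap φ h𝒜 e he
        map_zero' := LinearMap.ext fun v => Coind.ext fun g => by
          rw [constMap_apply, map_zero, smul_zero]
          rfl
        map_add' := fun n m => LinearMap.ext fun v => Coind.ext fun g => by
          rw [LinearMap.add_apply, Coind.add_apply, constMap_apply, constMap_apply,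
            constMap_apply, map_add, smul_add] }
      fun g a ha n => LinearMap.ext fun v => Coind.ext fun x => by
        change constMap φ h𝒜 e he (a • n) v x = (a • constMap φ h𝒜 e he n v) x
        rw [Coind.smul_apply ha, constMap_apply, constMap_apply,
          proj_smul N (mem_algShriek φ 𝒜 ha), smul_comm, map_mul, map_inv])
    fun _ _ hn v => constMap_mem e he hn v

theorem coindHomι_constHom (n : N) (v : V) (g : G) :
    coindHomι φ h𝒜 N V ((constHom h𝒜 N e he).lin n) v g = e v • N.isGrading.proj (φ g) n := rfl

/-- If `N` is supported on the image of `φ`, then `coindHom` with trivial coefficients is `N`. -/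
theorem isIso_constHom (hN : ∀ h, (∀ g, φ g ≠ h) → ∀ n ∈ N.deg h, n = 0) :
    IsIso (constHom h𝒜 N e he) := by
  have : Mono (constHom h𝒜 N e he) := by
    refine mono_of_injective _ (injective_of_homogeneous _ fun h n hn h0 => ?_)
    by_cases hh : ∃ g, φ g = h
    · obtain ⟨g, rfl⟩ := hh
      have h1 := coindHomι_constHom (h𝒜 := h𝒜) e he n (e.symm 1) g
      rw [h0, e.apply_symm_apply, one_smul, N.isGrading.proj_of_mem hn, map_zero] at h1
      exact h1.symm
    · push Not at hh
      exact hN h hh n hn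
  have : Epi (constHom h𝒜 N e he) := by
    refine epi_of_surjective _ (surjective_of_homogeneous _ fun h u hu => ?_)
    rw [mem_deg_coindHom] at hu
    by_cases hh : ∃ g, φ g = h
    · obtain ⟨g₀, rfl⟩ := hh
      refine ⟨coindHomι φ h𝒜 N V u (e.symm 1) g₀, coindHomι_injective φ h𝒜 N V
        (LinearMap.ext fun v => Coind.ext fun g => ?_)⟩
      rw [coindHomι_constHom]
      by_cases hg : φ g = φ g₀
      · rw [hg, N.isGrading.proj_of_mem (hu _ _).1]
        let l : φ.ker := ⟨g₀⁻¹ * g, by simp [MonoidHom.mem_ker, hg]⟩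
        have hl : g = g₀ * l := (mul_inv_cancel_left g₀ g).symm
        have hv : v = e v • e.symm 1 := by
          apply e.injective
          rw [map_smul, e.apply_symm_apply, smul_eq_mul, mul_one]
        have h1 : coindHomι φ h𝒜 N V u v g = coindHomι φ h𝒜 N V u v g₀ := by
          conv_rhs => rw [← he l v, map_smul, Coind.single_one_smul_apply, ← hl]
        have h2 : coindHomι φ h𝒜 N V u v = e v • coindHomι φ h𝒜 N V u (e.symm 1) := by
          conv_lhs => rw [hv, ← algebraMap_smul (MonoidAlgebra k φ.ker) (e v), map_smul,
            algebraMap_smul]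
        rw [h1, h2, Coind.scalar_smul_apply]
      · rw [N.isGrading.proj_of_mem_ne (hu _ _).1 (Ne.symm hg), smul_zero, (hu v g).2 hg]
    · push Not at hh
      refine ⟨0, coindHomι_injective φ h𝒜 N V (LinearMap.ext fun v => Coind.ext fun g => ?_)⟩
      rw [map_zero, map_zero, (hu v g).2 (hh g)]
      rfl
  exact isIso_of_mono_of_epi _

end Trivial

end GrMod

end GroupGraded

/-! ### The upper bound -/

namespace GroupGraded

open GrMod

variable {k A G H : Type u} [CommRing k] [Ring A] [Algebra k A] [Group G] [Group H]
  {𝒜 : G → Submodule k A} (φ : G →* H)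

theorem hasInjectiveDimensionLT_shriek_of_injective (h𝒜 : IsGradedAlgebra 𝒜)
    (hnoeth : IsGradedLeftNoetherian 𝒜) (n : ℕ)
    [HasProjectiveDimensionLT (ModuleCat.of.{u} (MonoidAlgebra k φ.ker)
      (Representation.trivial k φ.ker k).asModule) (n + 1)]
    (I : GrMod 𝒜) [Injective I] : HasInjectiveDimensionLT ((shriek φ).obj I) (n + 1) := by
  have : Injective (upperStar φ h𝒜 ((shriek φ).obj I)) := injective_upperStar_shriek hnoeth I
  let e := (Representation.trivial k φ.ker k).asModuleEquiv
  have : Module.Projective k (Representation.trivial k φ.ker k).asModule :=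
    Module.Projective.of_equiv e.symm
  have he : ∀ (l : φ.ker) (v : (Representation.trivial k φ.ker k).asModule),
      (MonoidAlgebra.single l 1 : MonoidAlgebra k φ.ker) • v = v := fun l v => by
    rw [Representation.single_smul, one_smul]
    rfl
  have := hasInjectiveDimensionLT_coindHom (h𝒜 := h𝒜) (N := (shriek φ).obj I) n
    (Representation.trivial k φ.ker k).asModule
  have := isIso_constHom (h𝒜 := h𝒜) (N := (shriek φ).obj I) e he
    fun h hh x hx => eq_zero_of_mem_degShriek φ I hx hh
  exact hasInjectiveDimensionLT_of_iso
    (asIso (constHom h𝒜 ((shriek φ).obj I) e he)).symm (n + 1)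

theorem hasInjectiveDimensionLT_shriek (h𝒜 : IsGradedAlgebra 𝒜)
    (hnoeth : IsGradedLeftNoetherian 𝒜) (n : ℕ)
    [HasProjectiveDimensionLT (ModuleCat.of.{u} (MonoidAlgebra k φ.ker)
      (Representation.trivial k φ.ker k).asModule) (n + 1)]
    (m : ℕ) (M : GrMod 𝒜) [HasInjectiveDimensionLT M (m + 1)] :
    HasInjectiveDimensionLT ((shriek φ).obj M) (m + n + 1) := by
  have := enoughInjectives h𝒜
  induction m generalizing M with
  | zero =>
    have : Injective M := injective_iff_hasInjectiveDimensionLT_one.2 ‹_›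
    rw [zero_add]
    exact hasInjectiveDimensionLT_shriek_of_injective φ h𝒜 hnoeth n M
  | succ m ih =>
    let f := Injective.ι M
    have h3 : HasInjectiveDimensionLT (quotSeq f).X₃ (m + 1) :=
      ((shortExact_quotSeq f).hasInjectiveDimensionLT_X₃_iff m inferInstance).2 ‹_›
    have hS := shriek_shortExact φ (quotSeq f) (injective_of_mono f) (quotSeq_exact f)
      (Submodule.mkQ_surjective _) (by rw [← (shriek φ).map_comp, (quotSeq f).zero]; rfl)
    have h2 := hasInjectiveDimensionLT_shriek_of_injective φ h𝒜 hnoeth n (Injective.under M)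
    rw [show m + 1 + n + 1 = (m + n + 1) + 1 by lia]
    exact hS.hasInjectiveDimensionLT_X₁ (m + n + 1) (ih _)
      (hasInjectiveDimensionLT_of_ge _ (n + 1) _ (by lia))

theorem injectiveDimension_le_shriek (h𝒜 : IsGradedAlgebra 𝒜) (M : GrMod 𝒜) :
    injectiveDimension M ≤ injectiveDimension ((shriek φ).obj M) := by
  refine le_of_forall_ge fun d hd => ?_
  induction d with
  | bot =>
    rw [le_bot_iff, injectiveDimension_eq_bot_iff, ← hasInjectiveDimensionLT_zero_iff_isZero] at *
    exact hasInjectiveDimensionLT_of_shriek φ h𝒜 0 M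
  | coe d =>
    induction d with
    | top => exact le_top
    | coe n =>
      have := (injectiveDimension_le_iff _ n).1 hd
      exact (injectiveDimension_le_iff _ n).2 (hasInjectiveDimensionLT_of_shriek φ h𝒜 (n + 1) M)

/-- If the trivial `k[L]`-module vanishes then so does `k`, hence every `A`-module. -/
theorem isZero_of_trivialProjDim_eq_bot {L : Type u} [Group L] (h : trivialProjDim k L = ⊥)
    (M : GrMod 𝒜) : IsZero M := by
  have h0 := (projectiveDimension_eq_bot_iff _).1 h
  have hk : (1 : k) = 0 := ((ModuleCat.isZero_iff_subsingleton).1 h0).elim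
    (1 : k) (0 : k)
  rw [IsZero.iff_id_eq_zero]
  refine hom_ext fun x => ?_
  change x = 0
  rw [← one_smul A x, ← map_one (algebraMap k A), hk, map_zero, zero_smul]

theorem injectiveDimension_shriek_le (h𝒜 : IsGradedAlgebra 𝒜) (hnoeth : IsGradedLeftNoetherian 𝒜)
    (M : GrMod 𝒜) : injectiveDimension ((shriek φ).obj M) ≤
      injectiveDimension M + trivialProjDim k φ.ker := by
  by_cases hM : IsZero M
  · rw [(injectiveDimension_eq_bot_iff _).2 (isZero_shriek_obj φ hM)]
    exact bot_le
  have hd : trivialProjDim k φ.ker ≠ ⊥ := fun h => hM (isZero_of_trivialProjDim_eq_bot h M)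
  have hi : injectiveDimension M ≠ ⊥ := fun h => hM ((injectiveDimension_eq_bot_iff M).1 h)
  generalize hdd : trivialProjDim k φ.ker = d at *
  generalize hii : injectiveDimension M = i at *
  induction d with
  | bot => exact absurd rfl hd
  | coe d =>
  induction i with
  | bot => exact absurd rfl hi
  | coe i =>
  induction d with
  | top =>
    rw [← WithBot.coe_add, add_top]
    exact le_top
  | coe n =>
  induction i with
  | top =>
    rw [← WithBot.coe_add, top_add]
    exact le_top
  | coe m =>
    have h1 : HasProjectiveDimensionLT (ModuleCat.of.{u} (MonoidAlgebra k φ.ker)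
        (Representation.trivial k φ.ker k).asModule) (n + 1) :=
      (projectiveDimension_le_iff _ n).1 hdd.le
    have h2 : HasInjectiveDimensionLT M (m + 1) := (injectiveDimension_le_iff _ m).1 hii.le
    have h3 := hasInjectiveDimensionLT_shriek φ h𝒜 hnoeth n m M
    refine ((injectiveDimension_le_iff _ (m + n)).2 h3).trans (le_of_eq ?_)
    push_cast
    rfl

end GroupGraded

theorem mainTheorem1 {k A G H : Type u} [CommRing k] [Ring A] [Algebra k A] [Group G] [Group H]
    (φ : G →* H) (𝒜 : G → Submodule k A) (h𝒜 : GroupGraded.IsGradedAlgebra 𝒜)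
    (hnoeth : GroupGraded.IsGradedLeftNoetherian 𝒜) :
    (∀ M : GroupGraded.GrMod 𝒜,
      injectiveDimension M ≤ injectiveDimension ((GroupGraded.shriek φ).obj M) ∧
      injectiveDimension ((GroupGraded.shriek φ).obj M) ≤
        injectiveDimension M + GroupGraded.trivialProjDim k φ.ker) ∧
    ∀ I : GroupGraded.GrMod 𝒜, CategoryTheory.Injective I →
      injectiveDimension ((GroupGraded.shriek φ).obj I) ≤ GroupGraded.trivialProjDim k φ.ker := by
  refine ⟨fun M => ⟨GroupGraded.injectiveDimension_le_shriek φ h𝒜 M,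
    GroupGraded.injectiveDimension_shriek_le φ h𝒜 hnoeth M⟩, fun I _ => ?_⟩
  refine (GroupGraded.injectiveDimension_shriek_le φ h𝒜 hnoeth I).trans ?_
  have h0 : injectiveDimension I ≤ ((0 : ℕ) : WithBot ℕ∞) :=
    (injectiveDimension_le_iff I 0).2 (injective_iff_hasInjectiveDimensionLT_one.1 ‹_›)
  exact (add_le_add_left h0 _).trans (le_of_eq (by simp))
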